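/- Let $\mathbb F$ be a field of characteristic $p>0$ and let $L$ be a finite-dimensional Lie algebra over $\mathbb F$, embedded in a restricted Lie algebra $(G,[p])$ over $\mathbb F$. Let $L_{(p)}$ be the $p$-envelope of $L$ in $G$, i.e. the smallest Lie subalgebra of $G$ that contains $L$ and is stable under the $p$-mapping $x\mapsto x^{[p]}$, and assume that $L_{(p)}$ is finite-dimensional. Put $q=\dim_{\mathbb F}(L_{(p)}/L)$. Then there are central elements $u_1,\dots,u_q$ of the enveloping algebra $U(L_{(p)})$ such that $U(L_{(p)})$ is the polynomial ring $U(L)[u_1,\dots,u_q]$: the natural map $U(L)\to U(L_{(p)})$ extends to an isomorphism of $\mathbb F$-algebras from the polynomial ring over $U(L)$ in $q$ variables (commuting with each other and with $U(L)$) onto $U(L_{(p)})$ that sends the $i$-th variable to $u_i$. Consequently, writing $K(L)$ and $K(L_{(p)})$ for the division rings of fractions of the Ore domains $U(L)$ and $U(L_{(p)})$, the polynomial ring $K(L)[X_1,\dots,X_q]$ in $q$ central variables is an Ore domain, and its division ring of fractions $K(L)(X_1,\dots,X_q)$ is isomorphic as an $\mathbb F$-algebra to $K(L_{(p)})$, by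 an isomorphism that extends the natural map $U(L)\to U(L_{(p)})$ and sends $X_i$ to $u_i$. -/

import Mathlib

open scoped TensorProduct nonZeroDivisors

noncomputable section

/-! ### Restricted Lie algebras and `p`-envelopes -/

/-- Jacobson's polynomials `s_i(x, y)`, for `i ≥ 1`: in the Lie algebra `F[T] ⊗ G`, the coefficient
of `T ^ (i - 1)` in `(ad (T ⊗ x + 1 ⊗ y)) ^ (p - 1) (1 ⊗ x)` is `i • s_i(x, y)`. -/
def jacobsonTerm (p : ℕ) (F : Type*) [Field F] {G : Type*} [LieRing G] [LieAlgebra F G]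
    (i : ℕ) (x y : G) : G :=
  (i : F)⁻¹ • TensorProduct.lid F G
    (LinearMap.rTensor G (Polynomial.lcoeff F (i - 1))
      (((LieAlgebra.ad (Polynomial F) (Polynomial F ⊗[F] G)
          ((Polynomial.X : Polynomial F) ⊗ₜ[F] x + (1 : Polynomial F) ⊗ₜ[F] y)) ^ (p - 1))
        ((1 : Polynomial F) ⊗ₜ[F] x)))

/-- `φ : G → G` is a `p`-mapping on the Lie algebra `G` over the field `F` (of characteristic `p`),
that is, `(G, φ)` is a restricted Lie algebra. -/
structure IsPMapping (p : ℕ) (F : Type*) [Field F] {G : Type*} [LieRing G] [LieAlgebra F G]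
    (φ : G → G) : Prop where
  ad_map : ∀ x : G, LieAlgebra.ad F G (φ x) = (LieAlgebra.ad F G x) ^ p
  map_smul : ∀ (a : F) (x : G), φ (a • x) = a ^ p • φ x
  map_add : ∀ x y : G,
    φ (x + y) = φ x + φ y + ∑ i ∈ Finset.Icc 1 (p - 1), jacobsonTerm p F i x y

section PEnvelope

variable {F G L : Type*} [Field F] [LieRing G] [LieAlgebra F G] [LieRing L] [LieAlgebra F L]

/-- The `p`-envelope in `(G, φ)` of a Lie algebra `L` embedded in `G` through `j`: the smallest
restricted Lie subalgebra of `G` that contains the image of `L`. -/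
def pEnvelope (φ : G → G) (j : L →ₗ⁅F⁆ G) : LieSubalgebra F G :=
  sInf {K : LieSubalgebra F G | (∀ x : L, j x ∈ K) ∧ ∀ x ∈ K, φ x ∈ K}

theorem pEnvelope_isLeast (φ : G → G) (j : L →ₗ⁅F⁆ G) :
    IsLeast {K : LieSubalgebra F G | (∀ x : L, j x ∈ K) ∧ ∀ x ∈ K, φ x ∈ K} (pEnvelope φ j) := by
  have key : ∀ x : G, x ∈ pEnvelope φ j ↔
      ∀ K : LieSubalgebra F G, ((∀ x : L, j x ∈ K) ∧ ∀ x ∈ K, φ x ∈ K) → x ∈ K := fun x => by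
    rw [pEnvelope, ← SetLike.mem_coe, LieSubalgebra.coe_sInf]
    simp
  exact ⟨⟨fun x => (key _).2 fun K hK => hK.1 x,
    fun x hx => (key _).2 fun K hK => hK.2 x ((key x).1 hx K hK)⟩, fun K hK => sInf_le hK⟩

/-- The map from `L` to its `p`-envelope. -/
def toPEnvelope (φ : G → G) (j : L →ₗ⁅F⁆ G) : L →ₗ⁅F⁆ pEnvelope φ j where
  toFun x := ⟨j x, (pEnvelope_isLeast φ j).1.1 x⟩
  map_add' x y := Subtype.ext (map_add j x y)
  map_smul' a x := Subtype.ext (map_smul j a x)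
  map_lie' {x y} := Subtype.ext (LieHom.map_lie j x y)

/-- The dimension of `L_(p) / L`. -/
def pEnvelopeCodim (φ : G → G) (j : L →ₗ⁅F⁆ G) : ℕ :=
  Module.finrank F
    (pEnvelope φ j ⧸ LinearMap.range (toPEnvelope φ j : L →ₗ[F] pEnvelope φ j))

end PEnvelope

section EnvelopingMap

attribute [local instance] LieRing.ofAssociativeRing

/-- The homomorphism `U(L) → U(M)` induced by a homomorphism `L → M` of Lie algebras. -/
def envelopingMap {F L M : Type*} [Field F] [LieRing L] [LieAlgebra F L] [LieRing M]
    [LieAlgebra F M] (f : L →ₗ⁅F⁆ M) :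
    UniversalEnvelopingAlgebra F L →ₐ[F] UniversalEnvelopingAlgebra F M :=
  UniversalEnvelopingAlgebra.lift F ((UniversalEnvelopingAlgebra.ι F).comp f)

end EnvelopingMap

/-! ### Polynomials in central variables over a possibly noncommutative ring -/

/-- The polynomial ring `R[u_i : i ∈ σ]`; the variables commute with each other and with `R`. -/
abbrev CentralPolynomial (σ R : Type*) [Semiring R] : Type _ := AddMonoidAlgebra R (σ →₀ ℕ)

namespace CentralPolynomial

variable {σ R : Type*} [Semiring R]

/-- The constant polynomials. -/
def const : R →+* CentralPolynomial σ R := AddMonoidAlgebra.singleZeroRingHom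

/-- The variables. -/
def var (i : σ) : CentralPolynomial σ R := AddMonoidAlgebra.single (Finsupp.single i 1) 1

end CentralPolynomial

/-! ### Skewfields of fractions -/

/-- A domain, possibly noncommutative, in which any two nonzero elements have a nonzero common
left multiple. -/
class IsOreDomain (A : Type*) [Ring A] : Prop extends IsDomain A where
  exists_common_multiple : ∀ a s : A, s ≠ 0 → ∃ a' s' : A, s' ≠ 0 ∧ s' * a = a' * s

instance IsOreDomain.oreSet (A : Type*) [Ring A] [IsOreDomain A] :
    OreLocalization.OreSet A⁰ :=
  Classical.choice <| OreLocalization.nonempty_oreSet_iff_of_noZeroDivisors.2 fun r s => by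
    obtain ⟨a', s', hs', h⟩ :=
      IsOreDomain.exists_common_multiple r (s : A) (nonZeroDivisors.coe_ne_zero s)
    exact ⟨a', ⟨s', mem_nonZeroDivisors_of_ne_zero hs'⟩, h⟩

/-- The division ring of fractions of an Ore domain. -/
abbrev SkewFrac (A : Type*) [Ring A] [IsOreDomain A] : Type _ := OreLocalization A⁰ A

/-- The embedding of an Ore domain in its division ring of fractions. -/
abbrev toSkewFrac (A : Type*) [Ring A] [IsOreDomain A] : A →+* SkewFrac A :=
  OreLocalization.numeratorRingHom

end

open scoped TensorProduct nonZeroDivisors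

noncomputable section

attribute [local instance] LieRing.ofAssociativeRing

/-! The envelope is reached from `L` by adjoining one `p`-th power at a time. If a subalgebra `K`
containing `L` is proper, minimality gives `c ∈ K` with `φ c ∉ K`. Since `ad (φ c) = (ad c) ^ p`,
the element `φ c` normalizes `K`, so `K + F φ c` is a subalgebra with `K` as an ideal. The same
identity makes `ι c ^ p - ι (φ c)` central in the enveloping algebra of the whole envelope; these
are the `u_i`. That one step adds exactly one polynomial variable follows from universal properties
alone: `c ^ p - X` satisfies the commutation relations of `φ c`, which gives mutually inverse maps
(`IsPthPowerExtension.isPolynomialExtension`). The chain is assembled in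
`exists_isPolynomialExtension_incl`.

The Poincaré–Birkhoff–Witt theorem serves the statement on fractions. `L` acts on polynomials by
multiplication up to lower degree; hence `U(L)` has no zero divisors, and for finite-dimensional `L`
its standard filtration grows polynomially. A domain of polynomial growth is Ore, since two nonzero
elements without a nonzero common left multiple would force exponential growth
(`IsOreDomain.of_polynomial_growth`).

Finally, every polynomial over `K(L)` has a constant left denominator, so `K(L)[X]` is Ore with the
same skewfield of fractions as `U(L)[X]`, that is, as `U(L_(p))`. -/

/-! ### The Poincaré–Birkhoff–Witt representation on polynomials -/

namespace PBW

open MvPolynomial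

/-! ### Filtration of polynomials by degree. -/

section Degree

variable (F : Type*) [Field F] (ι : Type*)

/-- Polynomials of total degree less than `n`. -/
def degLT (n : ℕ) : Submodule F (MvPolynomial ι F) :=
  restrictSupport F {m | m.degree < n}

variable {F ι}

theorem degLT_mono {m n : ℕ} (h : m ≤ n) : degLT F ι m ≤ degLT F ι n :=
  restrictSupport_mono _ fun _ hk => lt_of_lt_of_le hk h

theorem monomial_mem_degLT {m : ι →₀ ℕ} {n : ℕ} (h : m.degree < n) (a : F) :
    monomial m a ∈ degLT F ι n :=
  (monomial_mem_restrictSupport F).2 (Or.inl h)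

theorem map_mem_of_mem_degLT {V : Type*} [AddCommGroup V] [Module F V]
    (A : MvPolynomial ι F →ₗ[F] V) (N : Submodule F V) {n : ℕ}
    (h : ∀ m : ι →₀ ℕ, m.degree < n → A (monomial m 1) ∈ N) {f : MvPolynomial ι F}
    (hf : f ∈ degLT F ι n) : A f ∈ N := by
  have : degLT F ι n ≤ N.comap A := by
    rw [degLT, restrictSupport_eq_span, Submodule.span_le]
    rintro _ ⟨m, hm, rfl⟩
    exact h m hm
  exact this hf

theorem eqOn_degLT {V : Type*} [AddCommGroup V] [Module F V]
    {A B : MvPolynomial ι F →ₗ[F] V} {n : ℕ}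
    (h : ∀ m : ι →₀ ℕ, m.degree < n → A (monomial m 1) = B (monomial m 1))
    {f : MvPolynomial ι F} (hf : f ∈ degLT F ι n) : A f = B f := by
  have := map_mem_of_mem_degLT (A - B) ⊥ (fun m hm => by simp [h m hm]) hf
  simpa [sub_eq_zero] using this

theorem mem_degLT_iff {f : MvPolynomial ι F} {n : ℕ} :
    f ∈ degLT F ι n ↔ ∀ m ∈ f.support, m.degree < n := by
  rw [degLT, mem_restrictSupport_iff]; rfl

theorem mem_degLT_totalDegree (f : MvPolynomial ι F) : f ∈ degLT F ι (f.totalDegree + 1) := by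
  rw [mem_degLT_iff]
  intro m hm
  have := le_totalDegree hm
  rw [Finsupp.degree_apply]
  exact Nat.lt_succ_of_le this

theorem X_mul_mem_degLT (i : ι) {n : ℕ} {f : MvPolynomial ι F} (hf : f ∈ degLT F ι n) :
    X i * f ∈ degLT F ι (n + 1) := by
  refine map_mem_of_mem_degLT (LinearMap.mulLeft F (X i)) _ (fun m hm => ?_) hf
  rw [LinearMap.mulLeft_apply, X, monomial_mul]
  apply monomial_mem_degLT
  simp only [map_add, Finsupp.degree_single]
  omega

end Degree

/-! ### Recursive construction of the action of a Lie algebra on polynomials. -/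

section Action

variable {F L ι : Type*} [Field F] [LieRing L] [LieAlgebra F L] (b : Module.Basis ι F L)

theorem X_mul_monomial (j : ι) (t : ι →₀ ℕ) :
    (X j * monomial t 1 : MvPolynomial ι F) = monomial (Finsupp.single j 1 + t) 1 := by
  rw [X, monomial_mul, one_mul]

/-- The linear action with prescribed values on basis vectors and monomials. -/
def ofFun (f : ι → (ι →₀ ℕ) → MvPolynomial ι F) : L →ₗ[F] Module.End F (MvPolynomial ι F) :=
  b.constr F fun i => (basisMonomials ι F).constr F (f i)

@[simp] theorem ofFun_apply (f : ι → (ι →₀ ℕ) → MvPolynomial ι F) (i : ι) (m : ι →₀ ℕ) :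
    ofFun b f (b i) (monomial m 1) = f i m := by
  rw [ofFun, Module.Basis.constr_basis]
  exact (basisMonomials ι F).constr_basis F (f i) m

/-- The symbol of an element of `L`: the corresponding linear form. -/
def symbol : L →ₗ[F] MvPolynomial ι F := b.constr F X

@[simp] theorem symbol_basis (i : ι) : symbol b (b i) = X i := b.constr_basis F _ i

theorem basis_induction (P : L → Prop) (hb : ∀ i, P (b i)) (h0 : P 0)
    (hadd : ∀ x y, P x → P y → P (x + y)) (hsmul : ∀ (a : F) x, P x → P (a • x)) (x : L) : P x := by
  have : x ∈ Submodule.span F (Set.range b) := by rw [b.span_eq]; trivial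
  induction this using Submodule.span_induction with
  | mem x h => obtain ⟨i, rfl⟩ := h; exact hb i
  | zero => exact h0
  | add x y _ _ hx hy => exact hadd x y hx hy
  | smul a x _ hx => exact hsmul a x hx

theorem symbol_mul_mem (x : L) {n : ℕ} {f : MvPolynomial ι F} (hf : f ∈ degLT F ι n) :
    symbol b x * f ∈ degLT F ι (n + 1) := by
  induction x using basis_induction b with
  | hb i => rw [symbol_basis]; exact X_mul_mem_degLT i hf
  | h0 => simp
  | hadd x y hx hy => rw [map_add, add_mul]; exact add_mem hx hy
  | hsmul a x hx => rw [map_smul, smul_mul_assoc]; exact Submodule.smul_mem _ _ hx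

/-- The action multiplies by the symbol, up to terms of lower degree. -/
def IsFiltered (R : L →ₗ[F] Module.End F (MvPolynomial ι F)) : Prop :=
  ∀ i (m : ι →₀ ℕ), R (b i) (monomial m 1) - X i * monomial m 1 ∈ degLT F ι (m.degree + 1)

variable {b}

theorem IsFiltered.sub_mem {R : L →ₗ[F] Module.End F (MvPolynomial ι F)} (h : IsFiltered b R)
    (x : L) {n : ℕ} {f : MvPolynomial ι F} (hf : f ∈ degLT F ι n) :
    R x f - symbol b x * f ∈ degLT F ι n := by
  induction x using basis_induction b with
  | hb i =>
    refine map_mem_of_mem_degLT (R (b i) - LinearMap.mulLeft F (symbol b (b i))) _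
      (fun m hm => ?_) hf
    simp only [LinearMap.sub_apply, LinearMap.mulLeft_apply, symbol_basis]
    exact degLT_mono hm (h i m)
  | h0 => simp
  | hadd x y hx hy =>
    have := add_mem hx hy
    simp only [map_add, add_mul, LinearMap.add_apply]
    convert this using 1
    abel
  | hsmul a x hx =>
    have := Submodule.smul_mem _ a hx
    simpa only [map_smul, smul_mul_assoc, LinearMap.smul_apply, smul_sub] using this

theorem IsFiltered.map_mem {R : L →ₗ[F] Module.End F (MvPolynomial ι F)} (h : IsFiltered b R)
    (x : L) {n : ℕ} {f : MvPolynomial ι F} (hf : f ∈ degLT F ι n) :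
    R x f ∈ degLT F ι (n + 1) := by
  have := add_mem (degLT_mono n.le_succ (h.sub_mem x hf)) (symbol_mul_mem b x hf)
  simpa using this

variable (b)

theorem eqOn_degLT_of_basis {R R' : L →ₗ[F] Module.End F (MvPolynomial ι F)} {n : ℕ}
    (h : ∀ i (m : ι →₀ ℕ), m.degree < n → R (b i) (monomial m 1) = R' (b i) (monomial m 1))
    (x : L) {f : MvPolynomial ι F} (hf : f ∈ degLT F ι n) : R x f = R' x f := by
  induction x using basis_induction b with
  | hb i => exact eqOn_degLT (h i) hf
  | h0 => simp
  | hadd x y hx hy => simp [hx, hy]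
  | hsmul a x hx => simp [hx]

variable [LinearOrder ι]

/-- The exponent `m` splits as its smallest variable `j` and the rest `t`. -/
def Splits (m : ι →₀ ℕ) (j : ι) (t : ι →₀ ℕ) : Prop :=
  m = Finsupp.single j 1 + t ∧ ∀ k ∈ t.support, j ≤ k

theorem Splits.mem {m t : ι →₀ ℕ} {j : ι} (h : Splits m j t) : j ∈ m.support := by
  rw [h.1]; simp

theorem Splits.le {m t : ι →₀ ℕ} {j k : ι} (h : Splits m j t) (hk : k ∈ m.support) : j ≤ k := by
  by_cases hkt : k ∈ t.support
  · exact h.2 k hkt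
  · rw [h.1] at hk
    simp only [Finsupp.mem_support_iff, Finsupp.add_apply, not_not] at hk hkt
    rw [hkt, add_zero] at hk
    by_contra hne
    exact hk (Finsupp.single_eq_of_ne (by rintro rfl; exact hne le_rfl))

theorem Splits.unique {m t t' : ι →₀ ℕ} {j j' : ι} (h : Splits m j t) (h' : Splits m j' t') :
    j = j' ∧ t = t' := by
  have hj : j = j' := le_antisymm (h.le h'.mem) (h'.le h.mem)
  subst hj
  exact ⟨rfl, add_left_cancel (h.1.symm.trans h'.1)⟩

theorem Splits.degree {m t : ι →₀ ℕ} {j : ι} (h : Splits m j t) : m.degree = t.degree + 1 := by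
  rw [h.1, map_add, Finsupp.degree_single, add_comm]

theorem exists_splits {m : ι →₀ ℕ} (h : m ≠ 0) : ∃ j t, Splits m j t := by
  have hs : m.support.Nonempty := Finsupp.support_nonempty_iff.2 h
  refine ⟨m.support.min' hs, m - Finsupp.single (m.support.min' hs) 1, ?_, fun k hk => ?_⟩
  · have : Finsupp.single (m.support.min' hs) 1 ≤ m := by
      rw [Finsupp.single_le_iff]
      exact Nat.one_le_iff_ne_zero.2 (Finsupp.mem_support_iff.1 (Finset.min'_mem _ hs))
    rw [add_tsub_cancel_of_le this]
  · apply Finset.min'_le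
    exact Finsupp.support_tsub hk

open Classical in
/-- One step in the recursive construction of the action: from an action that is correct on
polynomials of degree less than `n` to one that is correct up to degree `n`. -/
def stepFun (R : L →ₗ[F] Module.End F (MvPolynomial ι F)) (i : ι) (m : ι →₀ ℕ) :
    MvPolynomial ι F :=
  if h : ∃ q : ι × (ι →₀ ℕ), q.1 < i ∧ Splits m q.1 q.2 then
    -- Here `m = x_j t` with `j < i`. The value is forced by `b_i b_j t = b_j b_i t + [b_i, b_j] t`:
    -- split `b_i t` as `x_i t` plus a remainder, and note that `b_j` must send `x_i t` to `x_i m`,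
    -- as `j` is minimal there. If `R` is filtered, it is then used only in degrees at most
    -- `t.degree`.
    X i * monomial m 1
      + R (b h.choose.1) (R (b i) (monomial h.choose.2 1) - X i * monomial h.choose.2 1)
      + R ⁅b i, b h.choose.1⁆ (monomial h.choose.2 1)
  else X i * monomial m 1

theorem stepFun_of_splits (R : L →ₗ[F] Module.End F (MvPolynomial ι F)) {i j : ι} {m t : ι →₀ ℕ}
    (hji : j < i) (h : Splits m j t) :
    stepFun b R i m = X i * monomial m 1
      + R (b j) (R (b i) (monomial t 1) - X i * monomial t 1)
      + R ⁅b i, b j⁆ (monomial t 1) := by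
  have hex : ∃ q : ι × (ι →₀ ℕ), q.1 < i ∧ Splits m q.1 q.2 := ⟨(j, t), hji, h⟩
  rw [stepFun, dif_pos hex]
  obtain ⟨h1, h2⟩ := hex.choose_spec.2.unique h
  rw [h1, h2]

theorem stepFun_of_le (R : L →ₗ[F] Module.End F (MvPolynomial ι F)) {i : ι} {m : ι →₀ ℕ}
    (h : ∀ k ∈ m.support, i ≤ k) : stepFun b R i m = X i * monomial m 1 := by
  rw [stepFun, dif_neg]
  rintro ⟨⟨j, t⟩, hj, hs⟩
  exact absurd (h j hs.mem) (not_le.2 hj)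

theorem le_or_splits (i : ι) (m : ι →₀ ℕ) :
    (∀ k ∈ m.support, i ≤ k) ∨ ∃ j t, j < i ∧ Splits m j t := by
  by_cases hm : m = 0
  · left; simp [hm]
  · obtain ⟨j, t, h⟩ := exists_splits hm
    rcases lt_or_ge j i with hji | hij
    · exact Or.inr ⟨j, t, hji, h⟩
    · exact Or.inl fun k hk => hij.trans (h.le hk)

/-- The approximations of the action. -/
def approx : ℕ → L →ₗ[F] Module.End F (MvPolynomial ι F)
  | 0 => ofFun b fun i m => X i * monomial m 1
  | n + 1 => ofFun b (stepFun b (approx n))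

theorem isFiltered_approx (n : ℕ) : IsFiltered b (approx b n) := by
  induction n with
  | zero => intro i m; simp [approx]
  | succ n ih =>
    intro i m
    rw [approx, ofFun_apply]
    rcases le_or_splits i m with h | ⟨j, t, hji, h⟩
    · simp [stepFun_of_le b _ h]
    · rw [stepFun_of_splits b _ hji h, add_assoc, add_sub_cancel_left, h.degree]
      exact add_mem (ih.map_mem _ (ih i t))
        (ih.map_mem _ (monomial_mem_degLT (Nat.lt_succ_self _) 1))

/-- The approximations stabilize: on a monomial of positive degree `stepFun` consults the previous
approximation only in smaller degrees, where two successive ones agree by induction. -/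
theorem approx_succ_eq (n : ℕ) (x : L) {f : MvPolynomial ι F} (hf : f ∈ degLT F ι (n + 1)) :
    approx b (n + 1) x f = approx b n x f := by
  induction n generalizing x f with
  | zero =>
    refine eqOn_degLT_of_basis b (fun i m hm => ?_) x hf
    have hm0 : m = 0 := by
      rw [← Finsupp.degree_eq_zero_iff]; omega
    subst hm0
    have h0 : ∀ k ∈ (0 : ι →₀ ℕ).support, i ≤ k := by simp
    conv_lhs => rw [approx, ofFun_apply, stepFun_of_le b _ h0]
    rw [approx, ofFun_apply]
  | succ n ih =>
    refine eqOn_degLT_of_basis b (fun i m hm => ?_) x hf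
    rw [approx, ofFun_apply]
    conv_rhs => rw [approx, ofFun_apply]
    rcases le_or_splits i m with h | ⟨j, t, hji, h⟩
    · rw [stepFun_of_le b _ h, stepFun_of_le b _ h]
    · rw [stepFun_of_splits b _ hji h, stepFun_of_splits b _ hji h]
      have ht : t.degree < n + 1 := by have := h.degree; omega
      have hmt := monomial_mem_degLT ht (1 : F)
      rw [ih _ hmt, ih _ hmt, ih _ (degLT_mono ht (isFiltered_approx b n i t))]

/-- The action of `L` on polynomials. -/
def action : L →ₗ[F] Module.End F (MvPolynomial ι F) :=
  -- From index `m.degree` on, the approximations agree on `m`, so this is their limit.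
  ofFun b fun i m => approx b m.degree (b i) (monomial m 1)

theorem approx_eq_of_le {n k : ℕ} (hnk : n ≤ k) (x : L) {f : MvPolynomial ι F}
    (hf : f ∈ degLT F ι (n + 1)) : approx b k x f = approx b n x f := by
  induction k, hnk using Nat.le_induction with
  | base => rfl
  | succ k hk ih => rw [approx_succ_eq b k x (degLT_mono (Nat.succ_le_succ hk) hf), ih]

theorem action_eq_approx {n : ℕ} (x : L) {f : MvPolynomial ι F}
    (hf : f ∈ degLT F ι (n + 1)) : action b x f = approx b n x f := by
  refine eqOn_degLT_of_basis b (fun i m hm => ?_) x hf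
  rw [action, ofFun_apply]
  exact (approx_eq_of_le b (Nat.le_of_lt_succ hm) _
    (monomial_mem_degLT (Nat.lt_succ_self _) 1)).symm

theorem isFiltered_action : IsFiltered b (action b) := fun i m => by
  rw [action, ofFun_apply]
  exact isFiltered_approx b _ i m

theorem action_of_le {i : ι} {m : ι →₀ ℕ} (h : ∀ k ∈ m.support, i ≤ k) :
    action b (b i) (monomial m 1) = X i * monomial m 1 := by
  rw [action, ofFun_apply]
  cases m.degree with
  | zero => simp [approx]
  | succ n => simp [approx, stepFun_of_le b _ h]

/-- This relation is built into `stepFun`. Besides the definition it needs only that `j` is still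
minimal in `x_i t`, so that `b_j` acts there by multiplication. -/
theorem action_comm_of_lt {i j : ι} {t : ι →₀ ℕ} (hji : j < i) (h : ∀ k ∈ t.support, j ≤ k) :
    action b (b i) (action b (b j) (monomial t 1)) =
      action b (b j) (action b (b i) (monomial t 1)) + action b ⁅b i, b j⁆ (monomial t 1) := by
  have hs : Splits (Finsupp.single j 1 + t) j t := ⟨rfl, h⟩
  have ht : monomial t (1 : F) ∈ degLT F ι (t.degree + 1) :=
    monomial_mem_degLT (Nat.lt_succ_self _) 1
  have hw := isFiltered_approx b t.degree i t
  have key : action b (b j) (X i * monomial t 1) = X i * (X j * monomial t 1) := by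
    rw [X_mul_monomial i, action_of_le b, ← X_mul_monomial, mul_left_comm]
    intro k hk
    by_cases hkt : k ∈ t.support
    · exact h k hkt
    · by_cases hki : k = i
      · exact hki ▸ hji.le
      · simp only [Finsupp.mem_support_iff, not_not, Finsupp.add_apply] at hk hkt
        rw [hkt, add_zero, Finsupp.single_eq_of_ne hki] at hk
        exact absurd rfl hk
  conv_lhs => rw [action_of_le b h, X_mul_monomial, action, ofFun_apply, hs.degree, approx,
    ofFun_apply, stepFun_of_splits b _ hji hs, ← action_eq_approx b _ hw,
    ← action_eq_approx b _ ht, ← action_eq_approx b _ ht, map_sub, key, ← X_mul_monomial]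
  abel

/-- Moves `b_j` to the left past both `b_k` and `b_i`. Write `b_k t` as `x_k t` plus terms of degree
at most that of `t`: on the first `j` is minimal, and on the rest the induction hypothesis applies.
The two middle terms of the result are exchanged by swapping `i` and `k`, so they cancel in the
commutator of `b_i` and `b_k`. -/
theorem action_lie_of_lt {n : ℕ} (ih : ∀ (x y : L), ∀ f ∈ degLT F ι n,
      action b x (action b y f) = action b y (action b x f) + action b ⁅x, y⁆ f)
    {i k j : ι} {t : ι →₀ ℕ} (ht : t.degree + 1 = n) (hji : j < i) (hjk : j < k)
    (h : ∀ l ∈ t.support, j ≤ l) :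
    action b (b i) (action b (b k) (action b (b j) (monomial t 1))) =
      action b (b j) (action b (b i) (action b (b k) (monomial t 1)))
        + action b ⁅b i, b j⁆ (action b (b k) (monomial t 1))
        + action b ⁅b k, b j⁆ (action b (b i) (monomial t 1))
        + action b ⁅b i, ⁅b k, b j⁆⁆ (monomial t 1) := by
  have htm : monomial t (1 : F) ∈ degLT F ι n := ht ▸ monomial_mem_degLT (Nat.lt_succ_self _) 1
  have hw : action b (b k) (monomial t 1) - X k * monomial t 1 ∈ degLT F ι n :=
    ht ▸ isFiltered_action b k t
  have key : action b (b i) (action b (b j) (action b (b k) (monomial t 1))) =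
      action b (b j) (action b (b i) (action b (b k) (monomial t 1)))
        + action b ⁅b i, b j⁆ (action b (b k) (monomial t 1)) := by
    have h1 := ih (b i) (b j) _ hw
    have h2 := action_comm_of_lt b (t := Finsupp.single k 1 + t) hji (fun l hl => by
      by_cases hlt : l ∈ t.support
      · exact h l hlt
      · by_cases hlk : l = k
        · exact hlk ▸ hjk.le
        · simp only [Finsupp.mem_support_iff, not_not, Finsupp.add_apply] at hl hlt
          rw [hlt, add_zero, Finsupp.single_eq_of_ne hlk] at hl
          exact absurd rfl hl)
    rw [← X_mul_monomial] at h2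
    have h3 := congrArg₂ (· + ·) h1 h2
    simp only [map_sub] at h3
    rw [← sub_eq_zero] at h3 ⊢
    rw [← h3]
    abel
  rw [action_comm_of_lt b hjk h, map_add, key, ih (b i) ⁅b k, b j⁆ _ htm]
  abel

/-- Induction on the degree. If `i` or `k` is at most every variable of `m`, the relation is
`action_comm_of_lt` up to antisymmetry. Otherwise the smallest variable `j` of `m` lies below both,
and the Jacobi identity closes the induction. -/
theorem action_comm (n : ℕ) (x y : L) {f : MvPolynomial ι F} (hf : f ∈ degLT F ι n) :
    action b x (action b y f) = action b y (action b x f) + action b ⁅x, y⁆ f := by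
  induction n generalizing x y f with
  | zero =>
    have : f = 0 := by
      rw [mem_degLT_iff] at hf
      rw [← support_eq_empty, Finset.eq_empty_iff_forall_notMem]
      exact fun m hm => absurd (hf m hm) (Nat.not_lt_zero _)
    simp [this]
  | succ n ih =>
    have hbasis : ∀ (i k : ι) (m : ι →₀ ℕ), m.degree < n + 1 →
        action b (b i) (action b (b k) (monomial m 1)) =
          action b (b k) (action b (b i) (monomial m 1))
            + action b ⁅b i, b k⁆ (monomial m 1) := by
      intro i k m hm
      have swap : ∀ {i k : ι}, action b (b i) (action b (b k) (monomial m 1)) =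
          action b (b k) (action b (b i) (monomial m 1)) + action b ⁅b i, b k⁆ (monomial m 1) →
          action b (b k) (action b (b i) (monomial m 1)) =
          action b (b i) (action b (b k) (monomial m 1))
            + action b ⁅b k, b i⁆ (monomial m 1) := by
        intro i k h
        rw [h, ← lie_skew (b i) (b k), map_neg, LinearMap.neg_apply]
        abel
      have easy : ∀ {i k : ι}, (∀ l ∈ m.support, k ≤ l) →
          action b (b i) (action b (b k) (monomial m 1)) =
          action b (b k) (action b (b i) (monomial m 1))
            + action b ⁅b i, b k⁆ (monomial m 1) ∨ i < k := by
        intro i k h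
        rcases lt_trichotomy i k with hik | rfl | hki
        · exact Or.inr hik
        · left; simp
        · exact Or.inl (action_comm_of_lt b hki h)
      rcases le_or_splits k m with hk | ⟨j, t, hjk, hs⟩
      · rcases easy (i := i) hk with h | hik
        · exact h
        · exact swap (action_comm_of_lt b hik fun l hl => hik.le.trans (hk l hl))
      rcases le_or_splits i m with hi | ⟨j', t', hji, hs'⟩
      · rcases easy (i := k) hi with h | hki
        · exact swap h
        · exact action_comm_of_lt b hki fun l hl => hki.le.trans (hi l hl)
      obtain ⟨rfl, rfl⟩ := hs.unique hs'
      -- Writing `m` as `b_j` acting on `t` turns the claim into a comparison of `action_lie_of_lt`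
      -- with its version for `i` and `k` swapped.
      have hm' : monomial m (1 : F) = action b (b j) (monomial t 1) := by
        rw [action_of_le b hs.2, X_mul_monomial, hs.1]
      have htn : t.degree < n := by have := hs.degree; omega
      have htm := monomial_mem_degLT htn (1 : F)
      have ih' : ∀ (x y : L), ∀ f ∈ degLT F ι (t.degree + 1),
        action b x (action b y f) = action b y (action b x f) + action b ⁅x, y⁆ f :=
        fun x y f hf => ih x y (degLT_mono htn hf)
      have e1 := action_lie_of_lt b ih' rfl hji hjk hs.2
      have e2 := action_lie_of_lt b ih' rfl hjk hji hs.2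
      have e3 := ih ⁅b i, b k⁆ (b j) htm
      have e4 := congrArg (action b (b j)) (ih (b i) (b k) htm)
      have e5 : ⁅b i, ⁅b k, b j⁆⁆ = ⁅⁅b i, b k⁆, b j⁆ + ⁅b k, ⁅b i, b j⁆⁆ := leibniz_lie _ _ _
      rw [hm', e1, e2, e3, e5, e4]
      simp only [map_add, LinearMap.add_apply]
      abel
    induction x using basis_induction b with
    | h0 => simp
    | hadd x x' hx hx' =>
      simp only [map_add, LinearMap.add_apply, add_lie, hx, hx']
      abel
    | hsmul a x hx => simp only [map_smul, LinearMap.smul_apply, smul_lie, hx, smul_add]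
    | hb i =>
      induction y using basis_induction b with
      | h0 => simp
      | hadd x x' hx hx' =>
        simp only [map_add, LinearMap.add_apply, lie_add, hx, hx']
        abel
      | hsmul a x hx => simp only [map_smul, LinearMap.smul_apply, lie_smul, hx, smul_add]
      | hb k =>
        exact eqOn_degLT (A := action b (b i) ∘ₗ action b (b k))
          (B := action b (b k) ∘ₗ action b (b i) + action b ⁅b i, b k⁆) (hbasis i k) hf

/-- The Poincaré–Birkhoff–Witt representation of `L` on polynomials. -/
def rep : L →ₗ⁅F⁆ Module.End F (MvPolynomial ι F) :=
  { action b with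
    map_lie' := fun {x y} => by
      refine LinearMap.ext fun f => ?_
      have := action_comm b _ x y (mem_degLT_totalDegree f)
      simp only [LieRing.of_associative_ring_bracket, AddHom.toFun_eq_coe,
        LinearMap.coe_toAddHom, LinearMap.sub_apply, Module.End.mul_apply, this]
      abel }

@[simp] theorem rep_apply (x : L) : rep b x = action b x := rfl

end Action

end PBW

/-! ### The Poincaré–Birkhoff–Witt theorem and the Ore property -/

namespace UniversalEnvelopingAlgebra

variable {F L : Type*} [Field F] [LieRing L] [LieAlgebra F L]

/-- By the universal property, the lift of `ι` into the generated subalgebra followed by the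
inclusion is the identity. -/
theorem adjoin_range_ι :
    Algebra.adjoin F (Set.range (ι F : L → UniversalEnvelopingAlgebra F L)) = ⊤ := by
  set S := Algebra.adjoin F (Set.range (ι F : L → UniversalEnvelopingAlgebra F L)) with hS
  let g : L →ₗ⁅F⁆ S :=
    { toFun := fun x => ⟨ι F x, Algebra.subset_adjoin ⟨x, rfl⟩⟩
      map_add' := fun x y => Subtype.ext (map_add (ι F) x y)
      map_smul' := fun a x => Subtype.ext (map_smul (ι F) a x)
      map_lie' := fun {x y} => Subtype.ext (LieHom.map_lie (ι F) x y) }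
  have h : S.val.comp (lift F g) = AlgHom.id F _ := by
    refine hom_ext F (LieHom.ext fun x => ?_)
    change S.val (lift F g (ι F x)) = ι F x
    rw [lift_ι_apply]; rfl
  refine Algebra.eq_top_iff.2 fun a => ?_
  have := DFunLike.congr_fun h a
  simp only [AlgHom.comp_apply, AlgHom.id_apply] at this
  rw [← this]
  exact (lift F g a).2

@[elab_as_elim]
theorem induction {P : UniversalEnvelopingAlgebra F L → Prop}
    (algebraMap : ∀ r : F, P (algebraMap F _ r)) (ι : ∀ x : L, P (ι F x))
    (add : ∀ a c, P a → P c → P (a + c)) (mul : ∀ a c, P a → P c → P (a * c))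
    (a : UniversalEnvelopingAlgebra F L) : P a := by
  have ha : a ∈ Algebra.adjoin F
      (Set.range (UniversalEnvelopingAlgebra.ι F : L → UniversalEnvelopingAlgebra F L)) := by
    rw [adjoin_range_ι]; trivial
  induction ha using Algebra.adjoin_induction with
  | mem x hx => obtain ⟨x, rfl⟩ := hx; exact ι x
  | algebraMap r => exact algebraMap r
  | add x y _ _ hx hy => exact add x y hx hy
  | mul x y _ _ hx hy => exact mul x y hx hy

variable (F L) in
/-- The first step of the standard filtration. -/
def filtOne : Submodule F (UniversalEnvelopingAlgebra F L) :=
  1 ⊔ LinearMap.range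
    ((ι F : L →ₗ⁅F⁆ UniversalEnvelopingAlgebra F L) : L →ₗ[F] UniversalEnvelopingAlgebra F L)

theorem one_le_filtOne : 1 ≤ filtOne F L := le_sup_left

theorem ι_mem_filtOne (x : L) : ι F x ∈ filtOne F L :=
  Submodule.mem_sup_right ⟨x, rfl⟩

theorem exists_mem_filtOne_pow (a : UniversalEnvelopingAlgebra F L) :
    ∃ n, a ∈ filtOne F L ^ n := by
  induction a using UniversalEnvelopingAlgebra.induction with
  | algebraMap r =>
    exact ⟨0, by rw [pow_zero]; exact Submodule.algebraMap_mem r⟩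
  | ι x => exact ⟨1, by rw [pow_one]; exact ι_mem_filtOne x⟩
  | add a c ha hc =>
    obtain ⟨n, hn⟩ := ha
    obtain ⟨k, hk⟩ := hc
    exact ⟨max n k, add_mem (pow_le_pow_right₀ one_le_filtOne (le_max_left _ _) hn)
      (pow_le_pow_right₀ one_le_filtOne (le_max_right _ _) hk)⟩
  | mul a c ha hc =>
    obtain ⟨n, hn⟩ := ha
    obtain ⟨k, hk⟩ := hc
    exact ⟨n + k, by rw [pow_add]; exact Submodule.mul_mem_mul hn hk⟩

theorem prod_mem_filtOne_pow {σ : Type*} (x : σ → L) (l : List σ) :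
    (l.map fun i => ι F (x i)).prod ∈ filtOne F L ^ l.length := by
  induction l with
  | nil =>
    rw [List.map_nil, List.prod_nil, List.length_nil, pow_zero]
    exact Submodule.one_le.1 le_rfl
  | cons i l ih =>
    rw [List.map_cons, List.prod_cons, List.length_cons, pow_succ']
    exact Submodule.mul_mem_mul (ι_mem_filtOne _) ih

/-- Exchanging two adjacent factors changes the product by one with their bracket in place of both,
hence one factor shorter. -/
theorem prod_sub_prod_mem_of_perm {σ : Type*} (x : σ → L) {l l' : List σ} (h : l.Perm l') {n : ℕ}
    (hn : l.length ≤ n + 1) :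
    (l.map fun i => ι F (x i)).prod - (l'.map fun i => ι F (x i)).prod ∈ filtOne F L ^ n := by
  induction h generalizing n with
  | nil => simp
  | @cons i l l' h ih =>
    rw [List.length_cons] at hn
    rw [List.map_cons, List.prod_cons, List.map_cons, List.prod_cons, ← mul_sub]
    cases n with
    | zero =>
      have hl : l = [] := List.length_eq_zero_iff.1 (by omega)
      subst hl
      rw [List.nil_perm.1 h]
      simp
    | succ n =>
      rw [pow_succ']
      exact Submodule.mul_mem_mul (ι_mem_filtOne _) (ih (by omega))
  | swap i k l =>
    simp only [List.length_cons] at hn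
    have : ((k :: i :: l).map fun i => ι F (x i)).prod - ((i :: k :: l).map fun i => ι F (x i)).prod
        = ι F ⁅x k, x i⁆ * (l.map fun i => ι F (x i)).prod := by
      simp only [List.map_cons, List.prod_cons, LieHom.map_lie,
        LieRing.of_associative_ring_bracket, sub_mul, mul_assoc]
    rw [this]
    refine pow_le_pow_right₀ one_le_filtOne (show l.length + 1 ≤ n by omega) ?_
    rw [pow_succ']
    exact Submodule.mul_mem_mul (ι_mem_filtOne _) (prod_mem_filtOne_pow x l)
  | trans h₁ h₂ ih₁ ih₂ =>
    have := add_mem (ih₁ hn) (ih₂ (h₁.length_eq ▸ hn))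
    simpa using this

end UniversalEnvelopingAlgebra

/-! ### Ordered monomials: independence, leading terms, straightening. -/

namespace PBW

open MvPolynomial UniversalEnvelopingAlgebra

variable {F L ι : Type*} [Field F] [LieRing L] [LieAlgebra F L]

theorem monomial_mul_mem_degLT (m : ι →₀ ℕ) {n : ℕ} {f : MvPolynomial ι F}
    (hf : f ∈ degLT F ι n) : monomial m 1 * f ∈ degLT F ι (m.degree + n) := by
  refine map_mem_of_mem_degLT (LinearMap.mulLeft F (monomial m 1)) _ (fun k hk => ?_) hf
  rw [LinearMap.mulLeft_apply, monomial_mul]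
  apply monomial_mem_degLT
  rw [map_add]
  omega

instance [Finite ι] (n : ℕ) : Finite {m : ι →₀ ℕ | m.degree < n} :=
  Finite.of_injective (β := ι → Fin n)
    (fun m i => ⟨m.1 i, (Finsupp.le_degree i m.1).trans_lt m.2⟩) fun m m' h => by
      ext i
      exact congrArg Fin.val (congrFun h i)

instance [Finite ι] (n : ℕ) : FiniteDimensional F (degLT F ι n) :=
  Module.Finite.of_basis (basisRestrictSupport F _)

theorem finrank_degLT_le [Finite ι] (n : ℕ) :
    Module.finrank F (degLT F ι n) ≤ n ^ Nat.card ι := by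
  rw [degLT, Module.finrank_eq_nat_card_basis
    (basisRestrictSupport F {m : ι →₀ ℕ | m.degree < n})]
  have : Nat.card (ι → Fin n) = n ^ Nat.card ι := by simp [Nat.card_fun]
  rw [← this]
  refine Nat.card_le_card_of_injective
    (fun m i => ⟨m.1 i, (Finsupp.le_degree i m.1).trans_lt m.2⟩) fun m m' h => ?_
  ext i
  exact congrArg Fin.val (congrFun h i)

variable [LinearOrder ι] (b : Module.Basis ι F L)

theorem splits_induction {P : (ι →₀ ℕ) → Prop} (h0 : P 0)
    (h : ∀ m j t, Splits m j t → P t → P m) (m : ι →₀ ℕ) : P m := by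
  induction hn : m.degree generalizing m with
  | zero => rw [(Finsupp.degree_eq_zero_iff m).1 hn]; exact h0
  | succ n ih =>
    have hm : m ≠ 0 := by rintro rfl; simp at hn
    obtain ⟨j, t, hs⟩ := exists_splits hm
    exact h m j t hs (ih t (by have := hs.degree; omega))

/-- The ordered monomials in the enveloping algebra. -/
def ordProd (m : ι →₀ ℕ) : UniversalEnvelopingAlgebra F L :=
  (((Finsupp.toMultiset m).sort).map fun i => UniversalEnvelopingAlgebra.ι F (b i)).prod

theorem ordProd_zero : ordProd b 0 = 1 := by simp [ordProd]

theorem ordProd_of_splits {m t : ι →₀ ℕ} {j : ι} (h : Splits m j t) :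
    ordProd b m = UniversalEnvelopingAlgebra.ι F (b j) * ordProd b t := by
  have : (Finsupp.toMultiset m).sort = j :: (Finsupp.toMultiset t).sort := by
    rw [h.1, map_add, Finsupp.toMultiset_single, one_smul, Multiset.singleton_add]
    exact Multiset.sort_cons _ _ _ fun k hk => h.2 k ((Finsupp.mem_toMultiset _ _).1 hk)
  rw [ordProd, this, List.map_cons, List.prod_cons, ordProd]

/-- The linear map sending a monomial to the corresponding ordered monomial in `U(L)`. -/
def ordMap : MvPolynomial ι F →ₗ[F] UniversalEnvelopingAlgebra F L :=
  (basisMonomials ι F).constr F (ordProd b)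

theorem ordMap_monomial (m : ι →₀ ℕ) : ordMap b (monomial m 1) = ordProd b m :=
  (basisMonomials ι F).constr_basis F _ m

/-- The action of the enveloping algebra on polynomials. -/
def envRep : UniversalEnvelopingAlgebra F L →ₐ[F] Module.End F (MvPolynomial ι F) :=
  lift F (rep b)

theorem envRep_ι (x : L) : envRep b (UniversalEnvelopingAlgebra.ι F x) = action b x := by
  rw [envRep, lift_ι_apply, rep_apply]

theorem envRep_ordProd_one (m : ι →₀ ℕ) : envRep b (ordProd b m) 1 = monomial m 1 := by
  induction m using splits_induction with
  | h0 => rw [ordProd_zero, map_one (envRep b)]; rfl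
  | h m j t h ih =>
    rw [ordProd_of_splits b h, map_mul, Module.End.mul_apply, ih, envRep_ι, action_of_le b h.2,
      X_mul_monomial, h.1]

/-- Acting on `1` is a left inverse of `ordMap`: this is the linear independence of ordered
monomials. -/
theorem envRep_ordMap_one (f : MvPolynomial ι F) : envRep b (ordMap b f) 1 = f := by
  have : (LinearMap.applyₗ (1 : MvPolynomial ι F)) ∘ₗ (envRep b).toLinearMap ∘ₗ ordMap b
      = LinearMap.id :=
    (basisMonomials ι F).ext fun m => by
      simp only [coe_basisMonomials, LinearMap.comp_apply, ordMap_monomial, LinearMap.id_apply]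
      exact envRep_ordProd_one b m
  exact DFunLike.congr_fun this f

theorem envRep_ordProd_sub_mem (m : ι →₀ ℕ) {n : ℕ} {f : MvPolynomial ι F}
    (hf : f ∈ degLT F ι (n + 1)) :
    envRep b (ordProd b m) f - monomial m 1 * f ∈ degLT F ι (m.degree + n) := by
  induction m using splits_induction with
  | h0 => simp [ordProd_zero]
  | h m j t h ih =>
    have h1 := (isFiltered_action b).map_mem (b j) ih
    have h2 := (isFiltered_action b).sub_mem (b j) (monomial_mul_mem_degLT t hf)
    have h3 : t.degree + (n + 1) = m.degree + n := by rw [h.degree]; omega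
    rw [add_assoc, h3] at h1
    rw [h3] at h2
    have := add_mem h1 h2
    rw [ordProd_of_splits b h, map_mul, Module.End.mul_apply, envRep_ι]
    rw [map_sub, sub_add_sub_cancel, symbol_basis, ← mul_assoc, X_mul_monomial, ← h.1] at this
    exact this

/-- Leading terms multiply as in the polynomial ring: for `f`, `g` of degrees at most `d`, `n`, the
error has degree strictly below `d + n`. -/
theorem envRep_ordMap_sub_mem {d n : ℕ} {f g : MvPolynomial ι F}
    (hf : f ∈ degLT F ι (d + 1)) (hg : g ∈ degLT F ι (n + 1)) :
    envRep b (ordMap b f) g - f * g ∈ degLT F ι (d + n) := by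
  refine map_mem_of_mem_degLT
    ((LinearMap.applyₗ g) ∘ₗ (envRep b).toLinearMap ∘ₗ ordMap b - LinearMap.mulRight F g) _
    (fun m hm => ?_) hf
  simp only [LinearMap.sub_apply, LinearMap.comp_apply, ordMap_monomial, LinearMap.mulRight_apply]
  exact degLT_mono (by omega) (envRep_ordProd_sub_mem b m hg)

theorem ι_mul_ordProd_sub_mem (i : ι) (m : ι →₀ ℕ) :
    UniversalEnvelopingAlgebra.ι F (b i) * ordProd b m - ordProd b (Finsupp.single i 1 + m)
      ∈ filtOne F L ^ m.degree := by
  have hlen : (i :: (Finsupp.toMultiset m).sort).length ≤ m.degree + 1 := by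
    rw [List.length_cons, Multiset.length_sort, Finsupp.card_toMultiset, Finsupp.degree_apply]
    exact le_rfl
  have hp : (i :: (Finsupp.toMultiset m).sort).Perm
      (Finsupp.toMultiset (Finsupp.single i 1 + m)).sort := by
    rw [← Multiset.coe_eq_coe, ← Multiset.cons_coe, Multiset.sort_eq, Multiset.sort_eq, map_add,
      Finsupp.toMultiset_single, one_smul, Multiset.singleton_add]
  have := prod_sub_prod_mem_of_perm (F := F) b hp hlen
  rwa [List.map_cons, List.prod_cons] at this

/-- Straightening: a basis vector times an ordered monomial is the ordered monomial with that index
inserted, up to an element of a lower step covered by induction. It yields both the spanning half of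
the theorem and the growth bound. -/
theorem filtOne_pow_le (n : ℕ) : filtOne F L ^ n ≤ (degLT F ι (n + 1)).map (ordMap b) := by
  induction n with
  | zero =>
    rw [pow_zero, Submodule.one_le]
    refine ⟨monomial 0 1, monomial_mem_degLT (by simp) 1, ?_⟩
    rw [ordMap_monomial, ordProd_zero]
  | succ n ih =>
    have hmono := Submodule.map_mono (f := ordMap b)
      (degLT_mono (F := F) (ι := ι) (Nat.le_succ (n + 1)))
    rw [pow_succ', Submodule.mul_le]
    intro w hw u hu
    obtain ⟨f, hf, rfl⟩ := ih hu
    rw [filtOne] at hw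
    obtain ⟨r, hr, _, ⟨x, rfl⟩, rfl⟩ := Submodule.mem_sup.1 hw
    obtain ⟨r, rfl⟩ := Submodule.mem_one.1 hr
    rw [add_mul, ← Algebra.smul_def]
    refine add_mem (Submodule.smul_mem _ _ (hmono ⟨f, hf, rfl⟩)) ?_
    induction x using basis_induction b with
    | h0 => simp
    | hadd x y hx hy =>
      rw [map_add, add_mul]
      exact add_mem (hx (Submodule.add_mem_sup hr ⟨x, rfl⟩)) (hy (Submodule.add_mem_sup hr ⟨y, rfl⟩))
    | hsmul a x hx =>
      rw [map_smul, smul_mul_assoc]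
      exact Submodule.smul_mem _ _ (hx (Submodule.add_mem_sup hr ⟨x, rfl⟩))
    | hb i =>
      refine map_mem_of_mem_degLT (LinearMap.mulLeft F (UniversalEnvelopingAlgebra.ι F (b i))
        ∘ₗ ordMap b) _ (fun m hm => ?_) hf
      have h1 := ι_mul_ordProd_sub_mem b i m
      have h2 := hmono (ih (pow_le_pow_right₀ one_le_filtOne (Nat.le_of_lt_succ hm) h1))
      have h3 : ordProd b (Finsupp.single i 1 + m) ∈ (degLT F ι (n + 1 + 1)).map (ordMap b) :=
        ⟨monomial (Finsupp.single i 1 + m) 1, monomial_mem_degLT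
          (by rw [map_add, Finsupp.degree_single]; omega) 1, ordMap_monomial b _⟩
      have := add_mem h2 h3
      rw [sub_add_cancel] at this
      rw [LinearMap.comp_apply, ordMap_monomial]
      exact this

theorem ordMap_surjective : Function.Surjective (ordMap b) := fun a => by
  obtain ⟨n, hn⟩ := exists_mem_filtOne_pow a
  obtain ⟨f, -, hf⟩ := filtOne_pow_le b n hn
  exact ⟨f, hf⟩

end PBW

/-! ### The enveloping algebra is a domain of polynomial growth. -/

namespace UniversalEnvelopingAlgebra

variable {F L : Type*} [Field F] [LieRing L] [LieAlgebra F L]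

-- If the elements attached to nonzero `f` and `g` had product zero, acting on `1` would leave `f *
-- g` equal to its own lower-order error, against additivity of the total degree.
open PBW in
instance : IsDomain (UniversalEnvelopingAlgebra F L) := by
  let b := Module.Basis.ofVectorSpace F L
  let _ : LinearOrder (Module.Basis.ofVectorSpaceIndex F L) :=
    IsWellOrder.linearOrder WellOrderingRel
  have : Nontrivial (UniversalEnvelopingAlgebra F L) := by
    refine nontrivial_of_ne 0 1 fun h => ?_
    have := DFunLike.congr_fun (congrArg (envRep b) h) 1
    rw [map_zero (envRep b), map_one (envRep b)] at this
    exact zero_ne_one this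
  have : NoZeroDivisors (UniversalEnvelopingAlgebra F L) := by
    refine ⟨fun {x y} h => ?_⟩
    obtain ⟨f, rfl⟩ := ordMap_surjective b x
    obtain ⟨g, rfl⟩ := ordMap_surjective b y
    by_contra! hfg
    have hf : f ≠ 0 := by rintro rfl; simp at hfg
    have hg : g ≠ 0 := by rintro rfl; simp at hfg
    have h1 := envRep_ordMap_sub_mem b (mem_degLT_totalDegree f) (mem_degLT_totalDegree g)
    have h2 : envRep b (ordMap b f) g = 0 := by
      conv_lhs => rw [← envRep_ordMap_one b g]
      rw [← Module.End.mul_apply, ← map_mul, h, map_zero]; rfl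
    rw [h2, zero_sub, neg_mem_iff, mem_degLT_iff] at h1
    obtain ⟨m, hm, hdeg⟩ := Finset.exists_mem_eq_sup _
      (MvPolynomial.support_nonempty.2 (mul_ne_zero hf hg)) (fun s => s.sum fun _ e => e)
    have h3 := h1 m hm
    have h4 := MvPolynomial.totalDegree_mul_of_isDomain hf hg
    rw [MvPolynomial.totalDegree, hdeg] at h4
    rw [← h4, Finsupp.degree_apply] at h3
    exact absurd h3 (lt_irrefl _)
  exact NoZeroDivisors.to_isDomain _

theorem fg_filtOne [FiniteDimensional F L] : (filtOne F L).FG :=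
  Submodule.FG.sup ⟨{1}, by simp [Submodule.one_eq_span]⟩ Submodule.FG.of_finite

theorem finrank_filtOne_pow_le [FiniteDimensional F L] (n : ℕ) :
    Module.finrank F ↥(filtOne F L ^ n) ≤ (n + 1) ^ Module.finrank F L := by
  have h := PBW.filtOne_pow_le (Module.finBasis F L) n
  have h1 := Submodule.finrank_mono h
  have h2 := Submodule.finrank_map_le (PBW.ordMap (Module.finBasis F L))
    (PBW.degLT F (Fin (Module.finrank F L)) (n + 1))
  have h3 := PBW.finrank_degLT_le (F := F) (ι := Fin (Module.finrank F L)) (n + 1)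
  rw [Nat.card_eq_fintype_card, Fintype.card_fin] at h3
  exact h1.trans (h2.trans h3)

end UniversalEnvelopingAlgebra

/-! ### The Ore condition from polynomial growth. -/

theorem exists_mul_add_one_pow_lt_two_pow (d m : ℕ) : ∃ k : ℕ, (k * d + 1) ^ m < 2 ^ k := by
  have h := tendsto_pow_const_div_const_pow_of_one_lt m (r := (2 : ℝ)) (by norm_num)
  have hpos : (0 : ℝ) < 1 / ((d : ℝ) + 1) ^ m := by positivity
  obtain ⟨k, hk, hk1⟩ := ((h.eventually (gt_mem_nhds hpos)).and
    (Filter.eventually_ge_atTop 1)).exists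
  refine ⟨k, ?_⟩
  rw [div_lt_div_iff₀ (by positivity) (by positivity), one_mul, ← mul_pow] at hk
  have h2 : (k * (d + 1)) ^ m < 2 ^ k := by exact_mod_cast hk
  -- Since `k ≥ 1`, `k * d + 1 ≤ k * (d + 1)`.
  refine lt_of_le_of_lt (Nat.pow_le_pow_left ?_ m) h2
  rw [mul_add, mul_one]
  omega

/-- A domain with a generating subspace of polynomial growth is an Ore domain. -/
theorem IsOreDomain.of_polynomial_growth {F A : Type*} [Field F] [Ring A] [Algebra F A]
    [IsDomain A] (W : Submodule F A) (hW : W.FG) (h1 : 1 ≤ W) (htop : ∀ a, ∃ n, a ∈ W ^ n)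
    {m : ℕ} (hm : ∀ n, Module.finrank F ↥(W ^ n) ≤ (n + 1) ^ m) : IsOreDomain A where
  exists_common_multiple a s hs := by
    by_contra! hne
    have ha : a ≠ 0 := by
      rintro rfl
      exact hne 0 1 one_ne_zero (by simp)
    obtain ⟨n₁, hn₁⟩ := htop a
    obtain ⟨n₂, hn₂⟩ := htop s
    set d := max n₁ n₂ with hd
    have had : a ∈ W ^ d := pow_le_pow_right₀ h1 (le_max_left _ _) hn₁
    have hsd : s ∈ W ^ d := pow_le_pow_right₀ h1 (le_max_right _ _) hn₂
    have hfin : ∀ n, FiniteDimensional F ↥(W ^ n) := fun n =>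
      Module.Finite.iff_fg.2 (hW.pow n)
    -- Without a common multiple, `(x, y) ↦ x * a + y * s` is injective, so `W ^ (n + d)` contains
    -- two independent copies of `W ^ n`.
    have hdouble : ∀ n, 2 * Module.finrank F ↥(W ^ n) ≤ Module.finrank F ↥(W ^ (n + d)) := by
      intro n
      let g : ↥(W ^ n) × ↥(W ^ n) →ₗ[F] ↥(W ^ (n + d)) :=
        LinearMap.codRestrict _
          (LinearMap.coprod (LinearMap.mulRight F a ∘ₗ (W ^ n).subtype)
            (LinearMap.mulRight F s ∘ₗ (W ^ n).subtype)) (by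
          rintro ⟨x, y⟩
          rw [pow_add]
          exact add_mem (Submodule.mul_mem_mul x.2 had) (Submodule.mul_mem_mul y.2 hsd))
      have hg : Function.Injective g := by
        rw [injective_iff_map_eq_zero]
        rintro ⟨x, y⟩ hxy
        have h : (x : A) * a + y * s = 0 := congrArg Subtype.val hxy
        have hx : (x : A) = 0 := by
          by_contra hx
          exact hne (-y) x hx (by rw [neg_mul]; exact eq_neg_of_add_eq_zero_left h)
        rw [hx, zero_mul, zero_add] at h
        have hy : (y : A) = 0 := (mul_eq_zero.1 h).resolve_right hs
        exact Prod.ext (Subtype.ext hx) (Subtype.ext hy)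
      have := LinearMap.finrank_le_finrank_of_injective hg
      rw [Module.finrank_prod] at this
      omega
    have hgrow : ∀ k, 2 ^ k ≤ Module.finrank F ↥(W ^ (k * d)) := by
      intro k
      induction k with
      | zero =>
        refine Nat.succ_le_of_lt (Module.finrank_pos_iff_exists_ne_zero.2
          ⟨⟨1, by rw [zero_mul, pow_zero]; exact Submodule.one_le.1 le_rfl⟩, fun h => one_ne_zero (congrArg Subtype.val h)⟩)
      | succ k ih =>
        have := hdouble (k * d)
        rw [Nat.succ_mul, pow_succ]
        omega
    obtain ⟨k, hk⟩ := exists_mul_add_one_pow_lt_two_pow d m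
    exact absurd ((hgrow k).trans (hm (k * d))) (not_le.2 hk)

theorem UniversalEnvelopingAlgebra.isOreDomain (F L : Type*) [Field F] [LieRing L]
    [LieAlgebra F L] [FiniteDimensional F L] : IsOreDomain (UniversalEnvelopingAlgebra F L) :=
  IsOreDomain.of_polynomial_growth (filtOne F L) fg_filtOne one_le_filtOne exists_mem_filtOne_pow
    finrank_filtOne_pow_le

/-! ### The universal property of polynomials in central variables -/

namespace CentralPolynomial

variable {F σ R S : Type*} [Field F] [Ring R] [Algebra F R] [Ring S] [Algebra F S]

variable (F σ R) in
/-- The constant polynomials, as an algebra homomorphism. -/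
def constAlgHom : R →ₐ[F] CentralPolynomial σ R := AddMonoidAlgebra.singleZeroAlgHom

theorem var_mul_comm (i : σ) (f : CentralPolynomial σ R) : var i * f = f * var i := by
  induction f using AddMonoidAlgebra.induction_linear with
  | zero => simp
  | add f g hf hg => rw [mul_add, add_mul, hf, hg]
  | single m r =>
    rw [var, AddMonoidAlgebra.single_mul_single, AddMonoidAlgebra.single_mul_single, one_mul,
      mul_one, add_comm]

variable (F) in
theorem var_mem_center (i : σ) : var i ∈ Subalgebra.center F (CentralPolynomial σ R) :=
  Subalgebra.mem_center_iff.2 fun f => (var_mul_comm i f).symm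

/-- The monomials in a family of central elements. -/
def centralMonomial (u : σ → Subalgebra.center F S) : Multiplicative (σ →₀ ℕ) →* S :=
  -- The center is commutative, so ordinary polynomial evaluation is available there.
  (((Subalgebra.center F S).val.comp (MvPolynomial.aeval u) : MvPolynomial σ F →ₐ[F] S) :
    MvPolynomial σ F →* S).comp (AddMonoidAlgebra.of F (σ →₀ ℕ))

theorem centralMonomial_single (u : σ → Subalgebra.center F S) (i : σ) :
    centralMonomial u (Multiplicative.ofAdd (Finsupp.single i 1)) = u i := by
  change ((MvPolynomial.aeval u (MvPolynomial.X i) : Subalgebra.center F S) : S) = u i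
  rw [MvPolynomial.aeval_X]

/-- The universal property of the polynomial ring in central variables. -/
def lift (f : R →ₐ[F] S) (u : σ → S) (hu : ∀ i, u i ∈ Subalgebra.center F S) :
    CentralPolynomial σ R →ₐ[F] S :=
  AddMonoidAlgebra.liftNCAlgHom f (centralMonomial fun i => (⟨u i, hu i⟩ : Subalgebra.center F S))
    fun r m => Subalgebra.mem_center_iff.1
      (SetLike.coe_mem (MvPolynomial.aeval (fun i => (⟨u i, hu i⟩ : Subalgebra.center F S))
        (AddMonoidAlgebra.of F (σ →₀ ℕ) m))) (f r)

theorem lift_const (f : R →ₐ[F] S) (u : σ → S) (hu : ∀ i, u i ∈ Subalgebra.center F S) (r : R) :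
    lift f u hu (const r) = f r := by
  change AddMonoidAlgebra.liftNC _ _ (AddMonoidAlgebra.single 0 r) = _
  rw [AddMonoidAlgebra.liftNC_single, ofAdd_zero, map_one, mul_one]; rfl

theorem lift_var (f : R →ₐ[F] S) (u : σ → S) (hu : ∀ i, u i ∈ Subalgebra.center F S) (i : σ) :
    lift f u hu (var i) = u i := by
  change AddMonoidAlgebra.liftNC _ _ (AddMonoidAlgebra.single _ 1) = _
  rw [AddMonoidAlgebra.liftNC_single, centralMonomial_single]
  change f 1 * _ = _
  rw [map_one, one_mul]

theorem hom_ext {f g : CentralPolynomial σ R →ₐ[F] S} (hc : ∀ r, f (const r) = g (const r))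
    (hv : ∀ i, f (var i) = g (var i)) : f = g := by
  refine AddMonoidAlgebra.algHom_ext' ?_ (AlgHom.ext hc)
  have key : ∀ m : σ →₀ ℕ, f (AddMonoidAlgebra.single m 1) = g (AddMonoidAlgebra.single m 1) := by
    intro m
    induction m using Finsupp.induction_linear with
    | zero => exact hc 1
    | add m k hm hk =>
      have : (AddMonoidAlgebra.single (m + k) 1 : CentralPolynomial σ R) =
          AddMonoidAlgebra.single m 1 * AddMonoidAlgebra.single k 1 := by
        rw [AddMonoidAlgebra.single_mul_single, one_mul]
      rw [this, map_mul, map_mul, hm, hk]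
    | single i n =>
      induction n with
      | zero => rw [Finsupp.single_zero]; exact hc 1
      | succ n ih =>
        have : (AddMonoidAlgebra.single (Finsupp.single i (n + 1)) 1 : CentralPolynomial σ R) =
            AddMonoidAlgebra.single (Finsupp.single i n) 1 * var i := by
          rw [var, AddMonoidAlgebra.single_mul_single, one_mul, Finsupp.single_add]
        rw [this, map_mul, map_mul, ih, hv]
  exact MonoidHom.ext fun m => key m.toAdd

end CentralPolynomial

/-! ### Polynomial extensions of enveloping algebras -/

section PolynomialExtension

variable {F : Type*} [Field F]

/-- `S` is the polynomial ring over `R` in the central variables `u`. -/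
def IsPolynomialExtension {σ R S : Type*} [Ring R] [Algebra F R] [Ring S] [Algebra F S]
    (f : R →ₐ[F] S) (u : σ → S) : Prop :=
  (∀ i, u i ∈ Subalgebra.center F S) ∧
    ∃ e : CentralPolynomial σ R ≃ₐ[F] S,
      (∀ a, e (CentralPolynomial.const a) = f a) ∧ ∀ i, e (CentralPolynomial.var i) = u i

theorem IsPolynomialExtension.comp_algEquiv {σ R R' S : Type*} [Ring R] [Algebra F R]
    [Ring R'] [Algebra F R'] [Ring S] [Algebra F S] {f : R →ₐ[F] S} {u : σ → S}
    (h : IsPolynomialExtension f u) (ε : R' ≃ₐ[F] R) :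
    IsPolynomialExtension (f.comp (ε : R' →ₐ[F] R)) u := by
  obtain ⟨hu, e, hc, hv⟩ := h
  refine ⟨hu, (AddMonoidAlgebra.mapAlgEquiv F (σ →₀ ℕ) ε).trans e, fun a => ?_, fun i => ?_⟩
  · rw [AlgEquiv.trans_apply]
    have : AddMonoidAlgebra.mapAlgEquiv F (σ →₀ ℕ) ε (CentralPolynomial.const a) =
        CentralPolynomial.const (ε a) := AddMonoidAlgebra.mapAlgHom_single _ _ _
    rw [this, hc]; rfl
  · rw [AlgEquiv.trans_apply]
    have : AddMonoidAlgebra.mapAlgEquiv F (σ →₀ ℕ) ε (CentralPolynomial.var i) =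
        CentralPolynomial.var i :=
      (AddMonoidAlgebra.mapAlgHom_single _ _ _).trans (congrArg _ (map_one ε))
    rw [this, hv]

variable {L M N : Type*} [LieRing L] [LieAlgebra F L] [LieRing M] [LieAlgebra F M]
  [LieRing N] [LieAlgebra F N]

open UniversalEnvelopingAlgebra

theorem envelopingMap_ι (f : L →ₗ⁅F⁆ M) (x : L) :
    envelopingMap f (ι F x) = ι F (f x) :=
  lift_ι_apply F _ x

theorem envelopingMap_comp (g : M →ₗ⁅F⁆ N) (f : L →ₗ⁅F⁆ M) :
    envelopingMap (g.comp f) = (envelopingMap g).comp (envelopingMap f) :=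
  hom_ext F (LieHom.ext fun x => by
    change envelopingMap _ (ι F x) = envelopingMap g (envelopingMap f (ι F x))
    simp only [envelopingMap_ι, LieHom.comp_apply])

theorem envelopingMap_id : envelopingMap (LieHom.id : L →ₗ⁅F⁆ L) = AlgHom.id F _ :=
  hom_ext F (LieHom.ext fun x => by
    change envelopingMap _ (ι F x) = ι F x
    rw [envelopingMap_ι, LieHom.id_apply])

/-- Isomorphic Lie algebras have isomorphic enveloping algebras. -/
def envelopingEquiv (e : L ≃ₗ⁅F⁆ M) :
    UniversalEnvelopingAlgebra F L ≃ₐ[F] UniversalEnvelopingAlgebra F M :=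
  AlgEquiv.ofAlgHom (envelopingMap e.toLieHom) (envelopingMap e.symm.toLieHom)
    (by rw [← envelopingMap_comp, ← envelopingMap_id]; congr 1; ext x; simp)
    (by rw [← envelopingMap_comp, ← envelopingMap_id]; congr 1; ext x; simp)

/-! ### Adjoining a single `p`-th power. -/

/-- `M` is the sum of the ideal `i(L)` and the line spanned by an element `z` that acts on `i(L)`
as the `p`-th power of the inner derivation given by `c`; `ret` and `coord` are the projections. -/
structure IsPthPowerExtension (p : ℕ) (i : L →ₗ⁅F⁆ M) (ret : M →ₗ[F] L) (coord : M →ₗ[F] F)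
    (c : L) (z : M) : Prop where
  decomp : ∀ x, x = i (ret x) + coord x • z
  ret_apply : ∀ y, ret (i y) = y
  coord_apply : ∀ y, coord (i y) = 0
  ret_gen : ret z = 0
  coord_gen : coord z = 1
  lie_gen : ∀ y, ⁅z, i y⁆ = i (((LieAlgebra.ad F L c) ^ p) y)

section

variable {p : ℕ} {i : L →ₗ⁅F⁆ M} {ret : M →ₗ[F] L} {coord : M →ₗ[F] F} {c : L} {z : M}

theorem IsPthPowerExtension.lie_eq (h : IsPthPowerExtension p i ret coord c z) (x y : M) :
    ⁅x, y⁆ = i (⁅ret x, ret y⁆ + coord x • ((LieAlgebra.ad F L c) ^ p) (ret y)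
      - coord y • ((LieAlgebra.ad F L c) ^ p) (ret x)) := by
  have hskew : ⁅i (ret x), z⁆ = -i (((LieAlgebra.ad F L c) ^ p) (ret x)) := by
    rw [← h.lie_gen, lie_skew]
  conv_lhs => rw [h.decomp x, h.decomp y]
  simp only [add_lie, lie_add, smul_lie, lie_smul, lie_self, h.lie_gen, map_add, map_sub,
    map_smul, LieHom.map_lie, hskew, smul_zero, add_zero, smul_neg]
  abel

end

variable (p : ℕ) [Fact p.Prime] [CharP F p]

/-- `ad a` is the difference of left and right multiplication by `a`, which commute; in
characteristic `p` its `p`-th power is the difference of their `p`-th powers. -/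
theorem pow_char_mul_sub_mul_pow_char {A : Type*} [Ring A] [Algebra F A] [Nontrivial A]
    (a c : A) : a ^ p * c - c * a ^ p = ((LieAlgebra.ad F A a) ^ p) c := by
  have : CharP (Module.End F A) p := charP_of_injective_algebraMap' F p
  rw [LieAlgebra.ad_eq_lmul_left_sub_lmul_right]
  rw [Pi.sub_apply, sub_pow_char_of_commute _ (LinearMap.commute_mulLeft_right (R := F) a a),
    LinearMap.pow_mulLeft, LinearMap.pow_mulRight]
  rfl

theorem ι_pow_char_mul_sub (x y : L) :
    ι F x ^ p * ι F y - ι F y * ι F x ^ p = ι F (((LieAlgebra.ad F L x) ^ p) y) := by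
  rw [pow_char_mul_sub_mul_pow_char (F := F)]
  generalize p = n
  induction n with
  | zero => rfl
  | succ n ih =>
    rw [pow_succ', Module.End.mul_apply, ih, pow_succ', Module.End.mul_apply, LieAlgebra.ad_apply,
      LieAlgebra.ad_apply, LieHom.map_lie]

/-- The source of the central variables: `ι x ^ p` and `ι z` have the same commutators with the
generators `ι y`. -/
theorem pow_char_sub_mem_center {x z : L} (h : LieAlgebra.ad F L z = (LieAlgebra.ad F L x) ^ p) :
    ι F x ^ p - ι F z ∈ Subalgebra.center F (UniversalEnvelopingAlgebra F L) := by
  rw [Subalgebra.mem_center_iff]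
  intro a
  induction a using UniversalEnvelopingAlgebra.induction with
  | algebraMap r => exact Algebra.commutes _ _
  | add a c ha hc => rw [add_mul, mul_add, ha, hc]
  | mul a c ha hc => rw [mul_assoc, hc, ← mul_assoc, ha, mul_assoc]
  | ι y =>
    have h1 := ι_pow_char_mul_sub (F := F) p x y
    rw [← h, LieAlgebra.ad_apply, LieHom.map_lie, LieRing.of_associative_ring_bracket] at h1
    rw [mul_sub, sub_mul, ← sub_eq_zero, ← neg_eq_zero]
    rw [← sub_eq_zero] at h1
    rw [← h1]
    abel

variable {p} {i : L →ₗ⁅F⁆ M} {ret : M →ₗ[F] L} {coord : M →ₗ[F] F} {c : L} {z : M}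

/-- The extension of a homomorphism on `U(L)` to `M`, sending `z` to `c ^ p - w`. -/
def IsPthPowerExtension.extend (h : IsPthPowerExtension p i ret coord c z) {T : Type*} [Ring T]
    [Algebra F T] (g : UniversalEnvelopingAlgebra F L →ₐ[F] T) (w : T)
    (hw : w ∈ Subalgebra.center F T) : M →ₗ⁅F⁆ T :=
  { (g.toLinearMap ∘ₗ ((ι F : L →ₗ⁅F⁆ UniversalEnvelopingAlgebra F L) :
        L →ₗ[F] UniversalEnvelopingAlgebra F L) ∘ₗ ret
      + coord.smulRight (g (ι F c ^ p) - w) : M →ₗ[F] T) with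
    map_lie' := fun {x y} => by
      -- As `w` is central, commuting with `c ^ p - w` gives the same derivation as commuting with
      -- `c ^ p`, namely `(ad c) ^ p`, which is how `z` acts.
      have key : ∀ y, (g (ι F c ^ p) - w) * g (ι F y) =
          g (ι F y) * (g (ι F c ^ p) - w) + g (ι F (((LieAlgebra.ad F L c) ^ p) y)) := fun y => by
        rw [← ι_pow_char_mul_sub, map_sub, map_mul, map_mul, sub_mul, mul_sub,
          Subalgebra.mem_center_iff.1 hw (g (ι F y))]
        abel
      have hx : coord ⁅x, y⁆ = 0 := by rw [h.lie_eq, h.coord_apply]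
      have hr := congrArg ret (h.lie_eq x y)
      rw [h.ret_apply] at hr
      simp only [AddHom.toFun_eq_coe, LinearMap.coe_toAddHom, LinearMap.add_apply,
        LinearMap.comp_apply, LinearMap.smulRight_apply, hx, hr, zero_smul, add_zero,
        LieRing.of_associative_ring_bracket, LieHom.coe_toLinearMap, AlgHom.toLinearMap_apply,
        map_add, map_sub, map_smul, LieHom.map_lie, map_mul, add_mul, mul_add, smul_mul_assoc,
        mul_smul_comm, key, smul_add, smul_comm (coord x) (coord y)]
      abel }

/-- If `U(N)` is a polynomial ring over `U(M)` and `M` is obtained from `L` by adding a `p`-th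
power, then `U(N)` is a polynomial ring over `U(L)` in one more variable. -/
theorem IsPthPowerExtension.isPolynomialExtension
    (h : IsPthPowerExtension p i ret coord c z) (k : M →ₗ⁅F⁆ N) {n : ℕ}
    {u : Fin n → UniversalEnvelopingAlgebra F N} (hu : IsPolynomialExtension (envelopingMap k) u)
    (hcenter : ι F (k (i c)) ^ p - ι F (k z) ∈
      Subalgebra.center F (UniversalEnvelopingAlgebra F N)) :
    IsPolynomialExtension (envelopingMap (k.comp i))
      (Fin.cons (ι F (k (i c)) ^ p - ι F (k z)) u : Fin (n + 1) → _) := by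
  obtain ⟨hu, e, hec, hev⟩ := hu
  have hcons : ∀ l, (Fin.cons (ι F (k (i c)) ^ p - ι F (k z)) u : Fin (n + 1) → _) l ∈
      Subalgebra.center F (UniversalEnvelopingAlgebra F N) := fun l => by
    cases l using Fin.cases with
    | zero => exact hcenter
    | succ l => exact hu l
  let A := CentralPolynomial (Fin (n + 1)) (UniversalEnvelopingAlgebra F L)
  -- The new variable `0` stands for `c ^ p - z`, so `z` has to go to `c ^ p - X_0`; the variables
  -- already present are shifted by `succ`.
  let ext : UniversalEnvelopingAlgebra F M →ₐ[F] A :=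
    lift F (h.extend (CentralPolynomial.constAlgHom F _ _) (CentralPolynomial.var 0)
      (CentralPolynomial.var_mem_center F 0))
  have ext_ι : ∀ x, ext (ι F x) = CentralPolynomial.const (ι F (ret x)) +
      coord x • (CentralPolynomial.const (ι F c ^ p) - CentralPolynomial.var 0) :=
    fun x => lift_ι_apply F _ x
  have ext_map : ∀ a, ext (envelopingMap i a) = CentralPolynomial.const a := by
    suffices ext.comp (envelopingMap i) = CentralPolynomial.constAlgHom F _ _ from
      fun a => DFunLike.congr_fun this a
    refine hom_ext F (LieHom.ext fun y => ?_)
    change ext (envelopingMap i (ι F y)) = CentralPolynomial.const (ι F y)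
    rw [envelopingMap_ι, ext_ι, h.ret_apply, h.coord_apply, zero_smul, add_zero]
  let back := CentralPolynomial.lift ext (fun l : Fin n => CentralPolynomial.var l.succ)
    fun l => CentralPolynomial.var_mem_center F l.succ
  let Φ := CentralPolynomial.lift (envelopingMap (k.comp i)) _ hcons
  have Φ_const : ∀ a, Φ (CentralPolynomial.const a) = envelopingMap k (envelopingMap i a) :=
    fun a => by rw [CentralPolynomial.lift_const, envelopingMap_comp]; rfl
  have Φ_zero : Φ (CentralPolynomial.var 0) = ι F (k (i c)) ^ p - ι F (k z) :=
    CentralPolynomial.lift_var _ _ _ _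
  have Φ_succ : ∀ l, Φ (CentralPolynomial.var (Fin.succ l)) = u l :=
    fun l => CentralPolynomial.lift_var _ _ _ _
  have Φ_ext : ∀ a, Φ (ext a) = envelopingMap k a := by
    suffices Φ.comp ext = envelopingMap k from fun a => DFunLike.congr_fun this a
    refine hom_ext F (LieHom.ext fun x => ?_)
    change Φ (ext (ι F x)) = envelopingMap k (ι F x)
    rw [ext_ι, map_add, map_smul, map_sub, Φ_const, Φ_const, Φ_zero, map_pow, map_pow]
    simp only [envelopingMap_ι, sub_sub_cancel]
    conv_rhs => rw [h.decomp x, map_add, map_add, map_smul, map_smul]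
  -- Since `e` is invertible, this identifies the inverse of `Φ` as `back ∘ e⁻¹`; only the other
  -- composite remains, and it is checked on constants and variables.
  have Φ_back : Φ.comp back = e := CentralPolynomial.hom_ext
    (fun a => by
      change Φ (back _) = e _
      rw [CentralPolynomial.lift_const, Φ_ext, hec])
    (fun l => by
      change Φ (back _) = e _
      rw [CentralPolynomial.lift_var, Φ_succ, hev])
  have symm_map : ∀ a, e.symm (envelopingMap k a) = CentralPolynomial.const a := fun a => by
    rw [← hec, e.symm_apply_apply]
  let E : A ≃ₐ[F] UniversalEnvelopingAlgebra F N := AlgEquiv.ofAlgHom Φ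
    (back.comp (e.symm : UniversalEnvelopingAlgebra F N →ₐ[F] _))
    (AlgHom.ext fun a => by
      change Φ.comp back (e.symm a) = a
      rw [Φ_back]
      exact e.apply_symm_apply a)
    (CentralPolynomial.hom_ext
      (fun a => by
        change back (e.symm (Φ _)) = _
        rw [Φ_const, symm_map, CentralPolynomial.lift_const, ext_map]; rfl)
      (fun l => by
        change back (e.symm (Φ _)) = _
        cases l using Fin.cases with
        | zero =>
          have : ι F (k (i c)) ^ p - ι F (k z) =
              envelopingMap k (envelopingMap i (ι F c ^ p) - ι F z) := by
            simp only [map_sub, map_pow, envelopingMap_ι]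
          rw [Φ_zero, this, symm_map, CentralPolynomial.lift_const, map_sub, ext_map, ext_ι,
            h.ret_gen, h.coord_gen, one_smul, map_zero, map_zero, zero_add, sub_sub_cancel]
          rfl
        | succ l =>
          rw [Φ_succ, ← hev, e.symm_apply_apply, CentralPolynomial.lift_var]; rfl))
  exact ⟨hcons, E, fun a => CentralPolynomial.lift_const _ _ _ _,
    fun l => CentralPolynomial.lift_var _ _ _ _⟩

theorem isPolynomialExtension_envelopingEquiv (e : L ≃ₗ⁅F⁆ M) :
    IsPolynomialExtension (envelopingMap e.toLieHom)
      (Fin.elim0 : Fin 0 → UniversalEnvelopingAlgebra F M) := by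
  let Φ : CentralPolynomial (Fin 0) (UniversalEnvelopingAlgebra F L) →ₐ[F] _ :=
    CentralPolynomial.lift (envelopingMap e.toLieHom) Fin.elim0 fun l => l.elim0
  refine ⟨fun l => l.elim0, AlgEquiv.ofAlgHom Φ ((CentralPolynomial.constAlgHom F _ _).comp
    ((envelopingEquiv e).symm : UniversalEnvelopingAlgebra F M →ₐ[F] _)) ?_ ?_,
    fun a => CentralPolynomial.lift_const _ _ _ _, fun l => l.elim0⟩
  · refine AlgHom.ext fun a => ?_
    change Φ (CentralPolynomial.const ((envelopingEquiv e).symm a)) = a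
    rw [CentralPolynomial.lift_const]
    exact (envelopingEquiv e).apply_symm_apply a
  · refine CentralPolynomial.hom_ext (fun a => ?_) fun l => l.elim0
    change CentralPolynomial.const ((envelopingEquiv e).symm (Φ _)) = CentralPolynomial.const a
    rw [CentralPolynomial.lift_const]
    exact congrArg _ ((envelopingEquiv e).symm_apply_apply a)

end PolynomialExtension

/-! ### Adding `p`-th powers one at a time -/

section Chain

variable {F M : Type*} [Field F] [LieRing M] [LieAlgebra F M]

/-- A Lie subalgebra enlarged by an element that normalizes it. -/
def LieSubalgebra.adjoinNormalizing (K : LieSubalgebra F M) (z : M)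
    (hz : ∀ y ∈ K, ⁅z, y⁆ ∈ K) : LieSubalgebra F M :=
  { K.toSubmodule ⊔ Submodule.span F {z} with
    lie_mem' := fun {x y} hx hy => by
      obtain ⟨x, hxK, w, hw, rfl⟩ := Submodule.mem_sup.1 hx
      obtain ⟨y, hyK, v, hv, rfl⟩ := Submodule.mem_sup.1 hy
      obtain ⟨a, rfl⟩ := Submodule.mem_span_singleton.1 hw
      obtain ⟨b, rfl⟩ := Submodule.mem_span_singleton.1 hv
      have hxz : ⁅x, z⁆ ∈ K := by rw [← lie_skew]; exact neg_mem (hz x hxK)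
      -- Brackets fall even into `K`, because `⁅z, z⁆ = 0`.
      refine Submodule.mem_sup_left (?_ : _ ∈ K)
      simp only [add_lie, lie_add, smul_lie, lie_smul, lie_self, smul_zero, add_zero]
      exact add_mem (add_mem (K.lie_mem hxK hyK) (K.smul_mem a (hz y hyK))) (K.smul_mem b hxz) }

variable {p : ℕ} {φ : M → M} {K : LieSubalgebra F M} {c : M}

/-- `K` is stable under `ad c`, hence under its `p`-th power `ad (φ c)`. -/
theorem lie_pMap_mem (had : ∀ x, LieAlgebra.ad F M (φ x) = (LieAlgebra.ad F M x) ^ p) (hc : c ∈ K)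
    (y : M) (hy : y ∈ K) : ⁅φ c, y⁆ ∈ K := by
  have := LieSubalgebra.coe_ad_pow F M K ⟨c, hc⟩ ⟨y, hy⟩ p
  rw [← had] at this
  change LieAlgebra.ad F M (φ c) y ∈ K
  rw [← this]
  exact SetLike.coe_mem _

/-- A linear functional that vanishes on `K` and equals `1` at `φ c` supplies the coordinate;
subtracting its multiple of `φ c` gives the projection to `K`. -/
theorem exists_isPthPowerExtension
    (had : ∀ x, LieAlgebra.ad F M (φ x) = (LieAlgebra.ad F M x) ^ p)
    (hc : c ∈ K) (hφc : φ c ∉ K) {K' : LieSubalgebra F M}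
    (hK' : K'.toSubmodule = K.toSubmodule ⊔ Submodule.span F {φ c}) (hle : K ≤ K')
    (hz : φ c ∈ K') :
    ∃ ret coord, IsPthPowerExtension p (LieSubalgebra.inclusion hle) ret coord ⟨c, hc⟩
      (⟨φ c, hz⟩ : K') := by
  obtain ⟨f, hf, hKf⟩ := Submodule.exists_le_ker_of_notMem (p := K.toSubmodule) hφc
  let t : M →ₗ[F] F := (f (φ c))⁻¹ • f
  have ht : t (φ c) = 1 := inv_mul_cancel₀ hf
  have htK : ∀ y ∈ K, t y = 0 := fun y hy => by
    change _ * f y = 0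
    rw [LinearMap.mem_ker.1 (hKf hy), mul_zero]
  let coord : K' →ₗ[F] F := t ∘ₗ K'.toSubmodule.subtype
  have hmem : ∀ x : K', (x : M) - t x • φ c ∈ K.toSubmodule := by
    rintro ⟨x, hx⟩
    rw [← LieSubalgebra.mem_toSubmodule, hK'] at hx
    obtain ⟨y, hy, w, hw, rfl⟩ := Submodule.mem_sup.1 hx
    obtain ⟨a, rfl⟩ := Submodule.mem_span_singleton.1 hw
    have : t (y + a • φ c) = a := by
      rw [map_add, htK y hy, zero_add, map_smul, ht, smul_eq_mul, mul_one]
    change y + a • φ c - t (y + a • φ c) • φ c ∈ _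
    rw [this, add_sub_cancel_right]
    exact hy
  let ret : K' →ₗ[F] K := LinearMap.codRestrict K.toSubmodule
    (K'.toSubmodule.subtype - coord.smulRight (φ c)) hmem
  have hret : ∀ x : K', (ret x : M) = (x : M) - t x • φ c := fun x => rfl
  refine ⟨ret, coord, fun x => Subtype.ext ?_, fun y => Subtype.ext ?_, fun y => htK y y.2,
    Subtype.ext ?_, ht, fun y => Subtype.ext ?_⟩
  · change (x : M) = ret x + t x • φ c
    rw [hret, sub_add_cancel]
  · rw [hret]
    change (y : M) - t y • φ c = y
    rw [htK y y.2, zero_smul, sub_zero]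
  · rw [hret]
    change φ c - t (φ c) • φ c = 0
    rw [ht, one_smul, sub_self]
  · change ⁅φ c, (y : M)⁆ = (((LieAlgebra.ad F K ⟨c, hc⟩) ^ p) y : K)
    rw [LieSubalgebra.coe_ad_pow, ← had]; rfl

/-- Induction on the codimension. The condition `hK` passes to larger subalgebras, and for `K ≠ ⊤`
it says that `K` itself is not stable under `φ`. The new variable is central in all of `U(M)`, since
the identity for `ad (φ c)` holds on `M`. -/
theorem exists_isPolynomialExtension_incl [Fact p.Prime] [CharP F p] [FiniteDimensional F M]
    (had : ∀ x, LieAlgebra.ad F M (φ x) = (LieAlgebra.ad F M x) ^ p) (n : ℕ)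
    (K : LieSubalgebra F M)
    (hK : ∀ K' : LieSubalgebra F M, K ≤ K' → (∀ x ∈ K', φ x ∈ K') → K' = ⊤)
    (hn : Module.finrank F K + n = Module.finrank F M) :
    ∃ u : Fin n → UniversalEnvelopingAlgebra F M,
      IsPolynomialExtension (envelopingMap K.incl) u := by
  induction n generalizing K with
  | zero =>
    have htop : K = ⊤ := by
      rw [← LieSubalgebra.toSubmodule_inj, LieSubalgebra.top_toSubmodule]
      exact Submodule.eq_top_of_finrank_eq hn
    subst htop
    exact ⟨_, isPolynomialExtension_envelopingEquiv LieSubalgebra.topEquiv⟩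
  | succ n ih =>
    have hne : K ≠ ⊤ := by
      rintro rfl
      have : Module.finrank F (⊤ : LieSubalgebra F M) = Module.finrank F M := finrank_top F M
      omega
    obtain ⟨c, hc, hφc⟩ : ∃ c ∈ K, φ c ∉ K := by
      by_contra! h
      exact hne (hK K le_rfl h)
    let K' := K.adjoinNormalizing (φ c) (lie_pMap_mem had hc)
    have hle : K ≤ K' := fun x hx => Submodule.mem_sup_left hx
    have hz : φ c ∈ K' := Submodule.mem_sup_right (Submodule.mem_span_singleton_self _)
    have hrank : Module.finrank F K' = Module.finrank F K + 1 :=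
      Submodule.finrank_sup_span_singleton (p := K.toSubmodule) hφc
    obtain ⟨u, hu⟩ := ih K' (fun K'' h => hK K'' (hle.trans h)) (by omega)
    obtain ⟨ret, coord, h⟩ := exists_isPthPowerExtension had hc hφc rfl hle hz
    exact ⟨_, h.isPolynomialExtension K'.incl hu (pow_char_sub_mem_center p (had c))⟩

theorem exists_isPolynomialExtension_of_injective [Fact p.Prime] [CharP F p]
    [FiniteDimensional F M] {L : Type*} [LieRing L] [LieAlgebra F L]
    (had : ∀ x, LieAlgebra.ad F M (φ x) = (LieAlgebra.ad F M x) ^ p)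
    (f : L →ₗ⁅F⁆ M) (hf : Function.Injective f)
    (hφ : ∀ K : LieSubalgebra F M, (∀ x, f x ∈ K) → (∀ x ∈ K, φ x ∈ K) → K = ⊤) :
    ∃ u : Fin (Module.finrank F (M ⧸ LinearMap.range (f : L →ₗ[F] M))) →
        UniversalEnvelopingAlgebra F M, IsPolynomialExtension (envelopingMap f) u := by
  obtain ⟨u, hu⟩ := exists_isPolynomialExtension_incl had
    (Module.finrank F (M ⧸ LinearMap.range (f : L →ₗ[F] M))) f.range
    (fun K hK => hφ K fun x => hK ⟨x, rfl⟩) (by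
      rw [add_comm]
      exact Submodule.finrank_quotient_add_finrank (LinearMap.range (f : L →ₗ[F] M)))
  refine ⟨u, ?_⟩
  convert hu.comp_algEquiv (envelopingEquiv (LieEquiv.ofInjective f hf)) using 1
  change _ = (envelopingMap f.range.incl).comp (envelopingMap _)
  rw [← envelopingMap_comp]
  rfl

end Chain

/-! ### Application to the `p`-envelope. -/

section PEnvelope

variable {p : ℕ} {F G L : Type*} [Field F] [LieRing G] [LieAlgebra F G] [LieRing L]
  [LieAlgebra F L]

theorem exists_isPolynomialExtension_pEnvelope [Fact p.Prime] [CharP F p] {φ : G → G}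
    (hφ : IsPMapping p F φ) (j : L →ₗ⁅F⁆ G) (hj : Function.Injective j)
    [FiniteDimensional F (pEnvelope φ j)] :
    ∃ u : Fin (pEnvelopeCodim φ j) → UniversalEnvelopingAlgebra F (pEnvelope φ j),
      IsPolynomialExtension (envelopingMap (toPEnvelope φ j)) u := by
  have hleast := pEnvelope_isLeast φ j
  let ψ : pEnvelope φ j → pEnvelope φ j := fun x => ⟨φ x, hleast.1.2 x x.2⟩
  refine exists_isPolynomialExtension_of_injective (p := p) (φ := ψ) (fun x => ?_) _
    (fun x y h => hj (congrArg Subtype.val h)) fun K hK hψ => ?_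
  · refine LinearMap.ext fun y => Subtype.ext ?_
    rw [LieSubalgebra.coe_ad_pow, ← hφ.ad_map]
    rfl
  -- A stable subalgebra of the envelope is also a stable subalgebra of `G`, so minimality of the
  -- envelope applies to it.
  · have hle : pEnvelope φ j ≤ K.map (pEnvelope φ j).incl := hleast.2
      ⟨fun x => ⟨_, hK x, rfl⟩, by
        rintro _ ⟨x, hx, rfl⟩
        exact ⟨ψ x, hψ x hx, rfl⟩⟩
    refine eq_top_iff.2 fun x _ => ?_
    obtain ⟨y, hy, hyx⟩ := hle x.2
    rwa [← Subtype.ext hyx]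

end PEnvelope

/-! ### Ore domains and division rings of fractions -/

section Ore

/-- Every element of `B` is a left fraction of elements of `A`. -/
def HasLeftDenominators {A B : Type*} [Ring A] [Ring B] (g : A →+* B) : Prop :=
  ∀ b, ∃ s a, s ≠ 0 ∧ g s * b = g a

theorem IsOreDomain.exists_common_denominators {A B : Type*} [Ring A] [IsOreDomain A] [Ring B]
    {g : A →+* B} (h : HasLeftDenominators g) (b₁ b₂ : B) :
    ∃ s a₁ a₂, s ≠ 0 ∧ g s * b₁ = g a₁ ∧ g s * b₂ = g a₂ := by
  obtain ⟨s₁, a₁, hs₁, h₁⟩ := h b₁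
  obtain ⟨s₂, a₂, hs₂, h₂⟩ := h b₂
  obtain ⟨y, x, hx, hxy⟩ := IsOreDomain.exists_common_multiple s₁ s₂ hs₂
  refine ⟨x * s₁, x * a₁, y * a₂, mul_ne_zero hx hs₁, ?_, ?_⟩
  · rw [map_mul, mul_assoc, h₁, map_mul]
  · rw [hxy, map_mul, mul_assoc, h₂, map_mul]

/-- Clearing a common left denominator of `b` and `c` reduces the condition to one on their
numerators in `A`. -/
theorem IsOreDomain.of_hasLeftDenominators {A B : Type*} [Ring A] [IsOreDomain A] [Ring B]
    [IsDomain B] {g : A →+* B} (hg : Function.Injective g) (h : HasLeftDenominators g) :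
    IsOreDomain B where
  exists_common_multiple b c hc := by
    obtain ⟨s, a₁, a₂, hs, h₁, h₂⟩ := exists_common_denominators h b c
    have hgs : g s ≠ 0 := (map_ne_zero_iff g hg).2 hs
    have ha₂ : a₂ ≠ 0 := by
      rintro rfl
      rw [map_zero] at h₂
      exact mul_ne_zero hgs hc h₂
    obtain ⟨y, x, hx, hxy⟩ := IsOreDomain.exists_common_multiple a₁ a₂ ha₂
    refine ⟨g y * g s, g x * g s, mul_ne_zero ((map_ne_zero_iff g hg).2 hx) hgs, ?_⟩
    rw [mul_assoc, h₁, mul_assoc, h₂, ← map_mul, hxy, map_mul]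

/-- If `t * c = b` over `B`, a common denominator in `A` of `t` and `b` turns this into a relation
between their numerators. -/
theorem HasLeftDenominators.comp {A B C : Type*} [Ring A] [IsOreDomain A] [Ring B]
    [IsDomain B] [Ring C] {g : A →+* B} {f : B →+* C} (hf : HasLeftDenominators f)
    (hg : Function.Injective g) (h : HasLeftDenominators g) : HasLeftDenominators (f.comp g) := by
  intro c
  obtain ⟨t, b, ht, htb⟩ := hf c
  obtain ⟨s, a₁, a₂, hs, h₁, h₂⟩ := IsOreDomain.exists_common_denominators h t b
  refine ⟨a₁, a₂, ?_, ?_⟩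
  · rintro rfl
    rw [map_zero] at h₁
    exact mul_ne_zero ((map_ne_zero_iff g hg).2 hs) ht h₁
  · rw [RingHom.comp_apply, RingHom.comp_apply, ← h₁, ← h₂, map_mul, map_mul, mul_assoc, htb]

theorem hasLeftDenominators_of_surjective {A B : Type*} [Ring A] [Nontrivial A] [Ring B]
    {g : A →+* B} (hg : Function.Surjective g) : HasLeftDenominators g := fun b => by
  obtain ⟨a, rfl⟩ := hg b
  exact ⟨1, a, one_ne_zero, by rw [map_one, one_mul]⟩

theorem IsOreDomain.of_ringEquiv {A B : Type*} [Ring A] [IsOreDomain A] [Ring B] (e : A ≃+* B) :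
    IsOreDomain B :=
  have : IsDomain B := e.symm.toMulEquiv.isDomain A
  .of_hasLeftDenominators (g := (e : A →+* B)) e.injective
    (hasLeftDenominators_of_surjective e.surjective)

variable (A : Type*) [Ring A] [IsOreDomain A]

theorem toSkewFrac_injective : Function.Injective (toSkewFrac A) :=
  OreLocalization.numeratorHom_inj inf_le_left

theorem hasLeftDenominators_toSkewFrac : HasLeftDenominators (toSkewFrac A) := fun x => by
  induction x using OreLocalization.ind with
  | _ r s => exact ⟨s, r, nonZeroDivisors.coe_ne_zero s, OreLocalization.mul_cancel⟩

variable {A} {F : Type*} [Field F] [Algebra F A]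

variable (A F) in
/-- The embedding of an Ore domain in its division ring of fractions, as an algebra
homomorphism. -/
def toSkewFracAlgHom : A →ₐ[F] SkewFrac A :=
  { toSkewFrac A with commutes' := fun _ => rfl }

/-- Nonzero elements of `A` become units in `K`, so `h` extends to fractions. Injectivity is
automatic on a division ring, and denominators give surjectivity. -/
theorem SkewFrac.exists_algEquiv {K : Type*} [DivisionRing K] [Algebra F K] (h : A →ₐ[F] K)
    (hinj : Function.Injective h) (hden : HasLeftDenominators (h : A →+* K)) :
    ∃ E : SkewFrac A ≃ₐ[F] K, ∀ a, E (toSkewFrac A a) = h a := by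
  have hne : ∀ s : A⁰, h (s : A) ≠ 0 := fun s =>
    (map_ne_zero_iff h hinj).2 (nonZeroDivisors.coe_ne_zero s)
  let hS : A⁰ →* Kˣ :=
    { toFun := fun s => Units.mk0 (h (s : A)) (hne s)
      map_one' := Units.ext (map_one h)
      map_mul' := fun s t => Units.ext (map_mul h (s : A) (t : A)) }
  let E : SkewFrac A →+* K := OreLocalization.universalHom (h : A →+* K) hS fun _ => rfl
  have hE : ∀ a, E (toSkewFrac A a) = h a := fun a => OreLocalization.universalHom_commutes _ _ _
  let E' : SkewFrac A →ₐ[F] K :=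
    { E with commutes' := fun r => (hE (algebraMap F A r)).trans (h.commutes r) }
  refine ⟨AlgEquiv.ofBijective E' ⟨E.injective, fun k => ?_⟩, hE⟩
  obtain ⟨s, a, hs, hsa⟩ := hden k
  refine ⟨(toSkewFrac A s)⁻¹ * toSkewFrac A a, ?_⟩
  change E _ = k
  have hhs : h s ≠ 0 := (map_ne_zero_iff h hinj).2 hs
  rw [map_mul, map_inv₀, hE, hE, inv_mul_eq_iff_eq_mul₀ hhs]
  exact hsa.symm

theorem SkewFrac.exists_algEquiv_of_algHom {B : Type*} [Ring B] [Algebra F B] [IsOreDomain B]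
    (g : A →ₐ[F] B) (hinj : Function.Injective g) (hden : HasLeftDenominators g.toRingHom) :
    ∃ E : SkewFrac A ≃ₐ[F] SkewFrac B, ∀ a, E (toSkewFrac A a) = toSkewFrac B (g a) :=
  SkewFrac.exists_algEquiv ((toSkewFracAlgHom B F).comp g) ((toSkewFrac_injective B).comp hinj)
    ((hasLeftDenominators_toSkewFrac B).comp hinj hden)

/-! ### Polynomials over the skewfield of fractions. -/

variable (σ : Type*)

instance {D : Type*} [Ring D] [IsDomain D] : IsDomain (CentralPolynomial σ D) :=
  NoZeroDivisors.to_isDomain _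

variable (A F) in
/-- The embedding of the polynomials over `A` in those over its division ring of fractions. -/
def polyToSkewFrac : CentralPolynomial σ A →ₐ[F] CentralPolynomial σ (SkewFrac A) :=
  AddMonoidAlgebra.mapAlgHom (σ →₀ ℕ) (toSkewFracAlgHom A F)

theorem polyToSkewFrac_single (m : σ →₀ ℕ) (a : A) :
    polyToSkewFrac A F σ (AddMonoidAlgebra.single m a) =
      AddMonoidAlgebra.single m (toSkewFrac A a) :=
  AddMonoidAlgebra.mapAlgHom_single _ _ _

theorem polyToSkewFrac_injective : Function.Injective (polyToSkewFrac A F σ) := fun f g h => by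
  ext m
  have := congrArg (fun q => q.coeff m) h
  simp only [polyToSkewFrac, AddMonoidAlgebra.coeff_mapAlgHom] at this
  exact toSkewFrac_injective A this

theorem hasLeftDenominators_polyToSkewFrac :
    HasLeftDenominators (polyToSkewFrac A F σ).toRingHom := by
  -- Asking for constant denominators lets the sum of two polynomials be treated with the Ore
  -- condition of `A` alone.
  suffices ∀ f : CentralPolynomial σ (SkewFrac A), ∃ (s : A) (g : CentralPolynomial σ A), s ≠ 0 ∧
      CentralPolynomial.const (toSkewFrac A s) * f = polyToSkewFrac A F σ g by
    intro f
    obtain ⟨s, g, hs, h⟩ := this f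
    refine ⟨CentralPolynomial.const s, g, ?_, ?_⟩
    · exact fun h0 => hs (AddMonoidAlgebra.single_eq_zero.1 h0)
    · exact (congrArg (· * f) (polyToSkewFrac_single σ 0 s)).trans h
  intro f
  have hconst : ∀ (x : SkewFrac A) (m : σ →₀ ℕ) (d : SkewFrac A),
      (CentralPolynomial.const x * AddMonoidAlgebra.single m d : CentralPolynomial σ _) =
        AddMonoidAlgebra.single m (x * d) := fun x m d => by
    rw [← zero_add m]
    exact (AddMonoidAlgebra.single_mul_single ..).trans (by rw [zero_add])
  have hmul : ∀ (x : A) (g : CentralPolynomial σ A),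
      (CentralPolynomial.const (toSkewFrac A x) * polyToSkewFrac A F σ g) =
        polyToSkewFrac A F σ (CentralPolynomial.const x * g) := fun x g => by
    rw [map_mul]
    exact congrArg (· * _) (polyToSkewFrac_single σ 0 x).symm
  induction f using AddMonoidAlgebra.induction_linear with
  | zero => exact ⟨1, 0, one_ne_zero, by rw [mul_zero, map_zero]⟩
  | single m d =>
    obtain ⟨s, a, hs, h⟩ := hasLeftDenominators_toSkewFrac A d
    exact ⟨s, AddMonoidAlgebra.single m a, hs, by rw [hconst, h, polyToSkewFrac_single]⟩
  | add f₁ f₂ h₁ h₂ =>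
    obtain ⟨s₁, g₁, hs₁, h₁⟩ := h₁
    obtain ⟨s₂, g₂, hs₂, h₂⟩ := h₂
    obtain ⟨y, x, hx, hxy⟩ := IsOreDomain.exists_common_multiple s₁ s₂ hs₂
    refine ⟨x * s₁, CentralPolynomial.const x * g₁ + CentralPolynomial.const y * g₂,
      mul_ne_zero hx hs₁, ?_⟩
    rw [mul_add, map_add, ← hmul, ← hmul, ← h₁, ← h₂, ← mul_assoc, ← mul_assoc, ← map_mul,
      ← map_mul, ← map_mul, ← map_mul, ← hxy]

theorem IsOreDomain.centralPolynomial_skewFrac (A F σ : Type*) [Ring A] [IsOreDomain A] [Field F]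
    [Algebra F A] [IsOreDomain (CentralPolynomial σ A)] :
    IsOreDomain (CentralPolynomial σ (SkewFrac A)) :=
  .of_hasLeftDenominators (g := (polyToSkewFrac A F σ).toRingHom)
    (polyToSkewFrac_injective σ) (hasLeftDenominators_polyToSkewFrac σ)

/-- Both sides are skewfields of fractions of the polynomials over `A`, through `polyToSkewFrac` and
`e` respectively. -/
theorem SkewFrac.exists_algEquiv_centralPolynomial {B : Type*} [Ring B] [Algebra F B]
    [IsOreDomain B] [IsOreDomain (CentralPolynomial σ (SkewFrac A))]
    (e : CentralPolynomial σ A ≃ₐ[F] B) :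
    ∃ E : SkewFrac (CentralPolynomial σ (SkewFrac A)) ≃ₐ[F] SkewFrac B,
      ∀ f, E (toSkewFrac _ (polyToSkewFrac A F σ f)) = toSkewFrac B (e f) := by
  have : IsOreDomain (CentralPolynomial σ A) := .of_ringEquiv e.symm.toRingEquiv
  obtain ⟨E₁, h₁⟩ := SkewFrac.exists_algEquiv_of_algHom (polyToSkewFrac A F σ)
    (polyToSkewFrac_injective σ) (hasLeftDenominators_polyToSkewFrac σ)
  obtain ⟨E₂, h₂⟩ := SkewFrac.exists_algEquiv_of_algHom e.toAlgHom e.injective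
    (hasLeftDenominators_of_surjective e.surjective)
  refine ⟨E₁.symm.trans E₂, fun f => ?_⟩
  rw [AlgEquiv.trans_apply, ← h₁, E₁.symm_apply_apply, h₂]
  rfl

end Ore

end

theorem proposition2p1p4 (p : ℕ) [Fact p.Prime] (F : Type*) [Field F] [CharP F p]
    {L G : Type*} [LieRing L] [LieAlgebra F L] [FiniteDimensional F L]
    [LieRing G] [LieAlgebra F G] (φ : G → G) (hφ : IsPMapping p F φ)
    (j : L →ₗ⁅F⁆ G) (hj : Function.Injective j) [FiniteDimensional F (pEnvelope φ j)] :
    ∃ u : Fin (pEnvelopeCodim φ j) → UniversalEnvelopingAlgebra F (pEnvelope φ j),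
      (∀ i, u i ∈ Subalgebra.center F (UniversalEnvelopingAlgebra F (pEnvelope φ j))) ∧
      (∃ e : CentralPolynomial (Fin (pEnvelopeCodim φ j)) (UniversalEnvelopingAlgebra F L) ≃ₐ[F]
            UniversalEnvelopingAlgebra F (pEnvelope φ j),
          (∀ a, e (CentralPolynomial.const a) = envelopingMap (toPEnvelope φ j) a) ∧
          ∀ i, e (CentralPolynomial.var i) = u i) ∧
      ∃ (_ : IsOreDomain (UniversalEnvelopingAlgebra F L))
        (_ : IsOreDomain (UniversalEnvelopingAlgebra F (pEnvelope φ j)))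
        (_ : IsOreDomain (CentralPolynomial (Fin (pEnvelopeCodim φ j))
          (SkewFrac (UniversalEnvelopingAlgebra F L))))
        (E : SkewFrac (CentralPolynomial (Fin (pEnvelopeCodim φ j))
            (SkewFrac (UniversalEnvelopingAlgebra F L))) ≃ₐ[F]
          SkewFrac (UniversalEnvelopingAlgebra F (pEnvelope φ j))),
          (∀ a, E (toSkewFrac _ (CentralPolynomial.const (toSkewFrac _ a))) =
            toSkewFrac _ (envelopingMap (toPEnvelope φ j) a)) ∧
          ∀ i, E (toSkewFrac _ (CentralPolynomial.var i)) = toSkewFrac _ (u i) := by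
  obtain ⟨u, hu, e, hec, hev⟩ := exists_isPolynomialExtension_pEnvelope hφ j hj
  have hL := UniversalEnvelopingAlgebra.isOreDomain F L
  have hM := UniversalEnvelopingAlgebra.isOreDomain F (pEnvelope φ j)
  -- The Ore property of `U(L)[X]` is carried over from `U(L_(p))` along `e`.
  have hP : IsOreDomain (CentralPolynomial (Fin (pEnvelopeCodim φ j))
      (UniversalEnvelopingAlgebra F L)) := .of_ringEquiv e.symm.toRingEquiv
  have hD := IsOreDomain.centralPolynomial_skewFrac (UniversalEnvelopingAlgebra F L) F
    (Fin (pEnvelopeCodim φ j))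
  obtain ⟨E, hE⟩ := SkewFrac.exists_algEquiv_centralPolynomial (Fin (pEnvelopeCodim φ j)) e
  refine ⟨u, hu, ⟨e, hec, hev⟩, hL, hM, hD, E, fun a => ?_, fun i => ?_⟩
  · rw [← hec, ← hE]
    exact congrArg (fun f => E (toSkewFrac _ f)) (polyToSkewFrac_single _ 0 a).symm
  · rw [← hev, ← hE]
    refine congrArg (fun f => E (toSkewFrac _ f)) ?_
    exact ((polyToSkewFrac_single _ _ 1).trans
      (congrArg (AddMonoidAlgebra.single _) (map_one _))).symm
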